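/- **Setting.** Let $d\ge 1$, $N\in\mathbb N$, let $D\subset\mathbb R^d$ be a bounded domain, $Y=(0,1)^d$, $V=H^1_0(D)$ and $f\in V'$. Write $C(\bar D,C_\#(\bar Y))$ for the functions $g(x,y)$ that are jointly continuous on $\bar D\times\mathbb R^d$ and $1$-periodic in each coordinate of $y$. Let $\bar A,\psi_1,\psi_2,\dots\in C(\bar D,C_\#(\bar Y))$ with $\inf_{x\in D,y\in Y}\bar A(x,y)>0$, and $\ell_1,\dots,\ell_N\in C(\bar D,C_\#(\bar Y))^d$. Let $U=[-1,1]^{\mathbb N}$ with its product Borel $\sigma$-algebra and the uniform prior $\rho=\bigotimes_{j\ge1}\frac{dz_j}{2}$. For $z\in U$ put $$A(z;x,y)=\bar A(x,y)+\sum_{j=1}^\infty z_j\psi_j(x,y).$$ Assume that there is $\kappa>0$ such that $$\sum_{j=1}^\infty\sup_{x\in D,\,y\in Y}|\psi_j(x,y)|\le\frac{\kappa}{1+\kappa}\inf_{x\in D,\,y\in Y}\bar A(x,y).$$ For $\varepsilon>0$ and $z\in U$ let $u^\varepsilon(z;\cdot)\in V$ be the weak solution of $-\nabla\cdot\big(A(z;x,\tfrac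 x\varepsilon)\nabla u^\varepsilon\big)=f$ in $D$, that is, $\int_D A(z;x,\tfrac x\varepsilon)\nabla u^\varepsilon\cdot\nabla\phi\,dx=\langle f,\phi\rangle$ for all $\phi\in V$, and let $$\mathcal G^\varepsilon(z)=\Big(\int_D\ell_i\big(x,\tfrac x\varepsilon\big)\cdot\nabla u^\varepsilon(z;x)\,dx\Big)_{i=1}^N\in\mathbb R^N .$$ Let $\Sigma\in\mathbb R^{N\times N}$ be symmetric positive definite and, for $\delta\in\mathbb R^N$, $$\Phi^\varepsilon(z,\delta)=\tfrac12(\delta-\mathcal G^\varepsilon(z))^{T}\Sigma^{-1}(\delta-\mathcal G^\varepsilon(z)),\qquad Z^\varepsilon(\delta)=\int_U\exp(-\Phi^\varepsilon(z,\delta))\,d\rho(z).$$ **Proposition 4.1 (uniform prior, existence and well-posedness).** 1. For every $\varepsilon>0$ and $z\in U$ the weak solution $u^\varepsilon(z;\cdot)$ exists and is unique, the map $\mathcal G^\varepsilon:U\to\mathbb R^N$ is measurable, $Z^\varepsilon(\delta)>0$ for all $\delta\in\mathbb R^N$, and the Bayes formula $$\frac{d\rho^{\delta,\varepsilon}}{d\rho}(z)=\frac{1}{Z^\varepsilon(\delta)}\exp(-\Phi^\varepsilon(z,\delta))$$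 defines a probability measure $\rho^{\delta,\varepsilon}$ on $U$ for every $\delta\in\mathbb R^N$. The map $\delta\mapsto\rho^{\delta,\varepsilon}$ is a Markov kernel, and it is the posterior $\mathbb P(z\,|\,\delta)$: if $z\sim\rho$ and $\nu\sim\mathcal N(0,\Sigma)$ are independent, it is a regular conditional distribution of $z$ given the noisy observation $\delta=\mathcal G^\varepsilon(z)+\nu$, and every regular conditional distribution of $z$ given $\delta$ agrees with it for Lebesgue-almost every $\delta\in\mathbb R^N$. 2. For every $r$ there is a constant $c(r)$, independent of $\varepsilon$, such that for all $\varepsilon>0$ and all $\delta,\delta'\in\mathbb R^N$ with $|\delta|\le r$ and $|\delta'|\le r$, $$d_{\rm Hell}(\rho^{\delta,\varepsilon},\rho^{\delta',\varepsilon})\le c(r)\,|\delta-\delta'|,$$ where $$d_{\rm Hell}(\mu,\mu')=\Big(\frac12\int_U\Big(\sqrt{\tfrac{d\mu}{d\rho}}-\sqrt{\tfrac{d\mu'}{d\rho}}\Big)^2d\rho\Big)^{1/2}.$$ -/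

import Mathlib

open MeasureTheory ProbabilityTheory

namespace TwoScale

open scoped ENNReal ContDiff RealInnerProductSpace

/-- Euclidean space of dimension `n`. -/
abbrev Euc (n : ℕ) : Type := EuclideanSpace ℝ (Fin n)

/-! ### The two-scale coefficient -/

/-- The unit cube `Y = (0,1)^d`. -/
def unitCube (d : ℕ) : Set (Euc d) := {y | ∀ i, y i ∈ Set.Ioo (0 : ℝ) 1}

/-- `g ∈ C(D̄, C_#(Ȳ))`: the function `g(x, y)` is jointly continuous in `x ∈ D̄` and `y`, and
`1`-periodic in every coordinate of `y` (functions on `Ȳ` are extended periodically). -/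
structure IsContPeriodic {d : ℕ} {F : Type*} [TopologicalSpace F] (D : Set (Euc d))
    (g : Euc d → Euc d → F) : Prop where
  continuousOn : ContinuousOn (fun p : Euc d × Euc d => g p.1 p.2) (closure D ×ˢ Set.univ)
  periodic : ∀ x ∈ closure D, ∀ y : Euc d, ∀ i : Fin d,
    g x (y + EuclideanSpace.single i 1) = g x y

/-- `inf_{x ∈ D, y ∈ Y} g(x, y)`. -/
noncomputable def cellInf {d : ℕ} (D : Set (Euc d)) (g : Euc d → Euc d → ℝ) : ℝ :=
  sInf ((fun p : Euc d × Euc d => g p.1 p.2) '' (D ×ˢ unitCube d))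

/-- `sup_{x ∈ D, y ∈ Y} |g(x, y)|`. -/
noncomputable def cellSupAbs {d : ℕ} (D : Set (Euc d)) (g : Euc d → Euc d → ℝ) : ℝ :=
  sSup ((fun p : Euc d × Euc d => |g p.1 p.2|) '' (D ×ˢ unitCube d))

/-- The parameter space `U = [-1,1]^ℕ`, with its product `σ`-algebra. -/
abbrev Param : Type := ℕ → Set.Icc (-1 : ℝ) 1

/-- The uniform probability measure `dz / 2` on `[-1,1]`. -/
noncomputable def uniformIcc : Measure (Set.Icc (-1 : ℝ) 1) := 
  (2 : ℝ≥0∞)⁻¹ • (volume : Measure ℝ).comap Subtype.val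

instance : IsProbabilityMeasure uniformIcc := by
  constructor
  have h : ((volume : Measure ℝ).comap (Subtype.val : Set.Icc (-1 : ℝ) 1 → ℝ)) Set.univ = 2 := by
    rw [comap_subtype_coe_apply measurableSet_Icc, Set.image_univ, Subtype.range_coe,
      Real.volume_Icc]
    norm_num
  rw [uniformIcc, Measure.smul_apply, h, smul_eq_mul]
  exact ENNReal.inv_mul_cancel (by norm_num) (by norm_num)

/-- The uniform prior `ρ = ⨂_j dz_j / 2` on `U`. -/
noncomputable def prior : Measure Param := Measure.infinitePi fun _ => uniformIcc

instance : IsProbabilityMeasure prior := by unfold prior; infer_instance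

/-- `A(z; x, y) = Ā(x, y) + ∑_j z_j ψ_j(x, y)`. -/
noncomputable def coeff {d : ℕ} (Abar : Euc d → Euc d → ℝ) (ψ : ℕ → Euc d → Euc d → ℝ)
    (z : Param) (x y : Euc d) : ℝ :=
  Abar x y + ∑' j, (z j : ℝ) * ψ j x y

/-! ### The space `V = H¹₀(D)` -/

/-- Pairs (square integrable function, square integrable vector field) on `D`, with the Hilbert
norm `(‖u‖² + ‖p‖²)^{1/2}`. The space `H¹(D)` embeds in it through `u ↦ (u, ∇u)`. -/
abbrev FunGradPairs {d : ℕ} (D : Set (Euc d)) : Type :=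
  WithLp 2 (Lp ℝ 2 (volume.restrict D) × Lp (Euc d) 2 (volume.restrict D))

/-- The pairs `(φ, ∇φ)` with `φ ∈ C_c^∞(D)`. -/
noncomputable def testPairs {d : ℕ} (D : Set (Euc d)) : Submodule ℝ (FunGradPairs D) where
  carrier := {w | ∃ φ : Euc d → ℝ, ContDiff ℝ ∞ φ ∧ HasCompactSupport φ ∧ tsupport φ ⊆ D ∧
    w.fst =ᵐ[volume.restrict D] φ ∧ w.snd =ᵐ[volume.restrict D] gradient φ}
  zero_mem' := by
    refine ⟨0, contDiff_const, HasCompactSupport.zero, by simp, ?_, ?_⟩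
    · exact Lp.coeFn_zero _ _ _
    · have h : gradient (0 : Euc d → ℝ) = 0 := by ext1 x; exact gradient_fun_const x 0
      rw [h]; exact Lp.coeFn_zero _ _ _
  add_mem' := by
    rintro a b ⟨φ, h1, h2, h3, h4, h5⟩ ⟨χ, k1, k2, k3, k4, k5⟩
    refine ⟨φ + χ, h1.add k1, h2.add k2,
      (tsupport_add φ χ).trans (Set.union_subset h3 k3), ?_, ?_⟩
    · exact (Lp.coeFn_add _ _).trans (h4.add k4)
    · have h : gradient (φ + χ) = gradient φ + gradient χ := by
        ext1 x
        simp only [gradient, Pi.add_apply]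
        rw [fderiv_add (h1.differentiable (by simp) x) (k1.differentiable (by simp) x), map_add]
      rw [h]; exact (Lp.coeFn_add _ _).trans (h5.add k5)
  smul_mem' := by
    rintro c a ⟨φ, h1, h2, h3, h4, h5⟩
    refine ⟨c • φ, h1.const_smul c, h2.smul_left (f := fun _ => c),
      (tsupport_smul_subset_right (fun _ => c) φ).trans h3, ?_, ?_⟩
    · exact (Lp.coeFn_smul _ _).trans (h4.const_smul c)
    · have h : gradient (c • φ) = c • gradient φ := by
        ext1 x
        simp only [gradient, Pi.smul_apply]
        rw [fderiv_const_smul (h1.differentiable (by simp) x), map_smulₛₗ]; rfl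
      rw [h]; exact (Lp.coeFn_smul _ _).trans (h5.const_smul c)

/-- `V = H¹₀(D)`, the closure of `C_c^∞(D)` in the `H¹` norm. An element is stored together with
its weak gradient, as the pair `(u, ∇u)`. -/
noncomputable def H10 {d : ℕ} (D : Set (Euc d)) : Submodule ℝ (FunGradPairs D) :=
  (testPairs D).topologicalClosure

/-- The weak gradient of an element of `H¹₀(D)`. -/
noncomputable def grad {d : ℕ} {D : Set (Euc d)} (u : H10 D) : Euc d → Euc d :=
  ⇑(u : FunGradPairs D).snd

/-! ### The forward problem -/

/-- `u ∈ H¹₀(D)` solves `-∇·(A(x, x/ε) ∇u) = f` weakly: `∫_D A(x, x/ε) ∇u·∇φ dx = ⟨f, φ⟩` for all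
`φ ∈ H¹₀(D)`. -/
def IsWeakSolution {d : ℕ} (D : Set (Euc d)) (A : Euc d → Euc d → ℝ) (ε : ℝ)
    (f : H10 D →L[ℝ] ℝ) (u : H10 D) : Prop :=
  ∀ φ : H10 D, ∫ x in D, A x (ε⁻¹ • x) * ⟪grad u x, grad φ x⟫ = f φ

/-- The weak solution `u^ε` (meaningful when there is exactly one). -/
noncomputable def weakSolution {d : ℕ} (D : Set (Euc d)) (A : Euc d → Euc d → ℝ) (ε : ℝ)
    (f : H10 D →L[ℝ] ℝ) : H10 D :=
  Classical.epsilon (IsWeakSolution D A ε f)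

/-- The forward map `G^ε(z) = (O_1^ε(z), …, O_N^ε(z))`, where
`O_i^ε(z) = ∫_D ℓ_i(x, x/ε)·∇u^ε(z; x) dx`. -/
noncomputable def forwardMap {d N : ℕ} (D : Set (Euc d)) (f : H10 D →L[ℝ] ℝ)
    (Abar : Euc d → Euc d → ℝ) (ψ : ℕ → Euc d → Euc d → ℝ)
    (l : Fin N → Euc d → Euc d → Euc d) (ε : ℝ) (z : Param) : Euc N :=
  WithLp.toLp 2 fun i =>
    ∫ x in D, ⟪l i x (ε⁻¹ • x), grad (weakSolution D (coeff Abar ψ z) ε f) x⟫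

/-! ### The Bayesian inverse problem -/

/-- The misfit `Φ^ε(z, δ) = ½ |δ - G^ε(z)|_S² = ½ (δ - G^ε(z))ᵀ S⁻¹ (δ - G^ε(z))`, as a function
of `z`. -/
noncomputable def misfit {d N : ℕ} (D : Set (Euc d)) (f : H10 D →L[ℝ] ℝ)
    (Abar : Euc d → Euc d → ℝ) (ψ : ℕ → Euc d → Euc d → ℝ)
    (l : Fin N → Euc d → Euc d → Euc d) (S : Matrix (Fin N) (Fin N) ℝ) (ε : ℝ) (δ : Euc N)
    (z : Param) : ℝ :=
  2⁻¹ * ((δ - forwardMap D f Abar ψ l ε z).ofLp ⬝ᵥ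
    (S⁻¹).mulVec (δ - forwardMap D f Abar ψ l ε z).ofLp)

/-- The normalizing constant `∫_U exp(-Φ) dρ`. -/
noncomputable def normConst (Φ : Param → ℝ) : ℝ := ∫ z, Real.exp (-Φ z) ∂prior

/-- The measure on `U` with density `exp(-Φ) / ∫_U exp(-Φ) dρ` with respect to the prior `ρ`. -/
noncomputable def bayesMeasure (Φ : Param → ℝ) : Measure Param :=
  prior.withDensity fun z => ENNReal.ofReal (Real.exp (-Φ z) / normConst Φ)

/-- The Hellinger distance, with the prior `ρ` as reference measure:
`(½ ∫_U (√(dμ/dρ) - √(dμ'/dρ))² dρ)^{1/2}`. -/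
noncomputable def hellingerDist (μ μ' : Measure Param) : ℝ :=
  √(2⁻¹ * ∫ z, (√((μ.rnDeriv prior z).toReal) - √((μ'.rnDeriv prior z).toReal)) ^ 2 ∂prior)

end TwoScale

namespace TwoScale
open scoped ENNReal RealInnerProductSpace MatrixOrder

/-! ### The density of a centred Gaussian -/

/-! Everything about the differential equation enters through two facts about the forward map: it is
bounded uniformly in `ε` and `z`, and for fixed `ε` it is continuous in `z` for the product
topology, hence measurable (`forwardMap_bound_and_continuous`). Both are energy estimates. The
coefficient lies between positive constants that do not see `ε`, because its bounds hold for all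
values of the fast variable. With the Poincaré inequality (`exists_norm_le_norm_grad`), Lax–Milgram
gives the unique solution together with `‖∇u‖ ≤ C‖f‖/m`. Subtracting two weak formulations gives
`‖∇u - ∇u'‖ ≤ sup|A - A'| ‖∇u'‖ / m` (`norm_gradL_sub_le`), and `sup|A - A'|` is at most `∑ |z_j -
z'_j| sup|ψ_j|`, which is continuous in the product topology by summability.

The rest is Bayesian and uses only a bounded measurable `G`. The noise has density `c
exp(-xᵀS⁻¹x/2)` (`multivariateGaussian_eq_withDensity`), so by translation invariance the pair
(datum, parameter) has density `c exp(-Φ)` with respect to Lebesgue measure times the prior.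
Disintegrating this density yields the Bayes kernel. The datum has the everywhere positive density
`c Z(δ)`, so uniqueness almost surely in the datum is uniqueness Lebesgue-almost everywhere
(`hasCondDistrib_bayesKernel`).

For the Hellinger bound, the root of the posterior density is `exp(-(Φ + log Z)/2)`. On a ball of
data `Φ` is bounded and Lipschitz in `δ`, uniformly in `z` and `ε`; `log Z` inherits the Lipschitz
bound, and the exponential is Lipschitz on half-lines bounded above
(`hellingerDist_bayesMeasure_le`). -/

lemma integrable_exp_neg_sq_norm {E : Type*} [NormedAddCommGroup E] [InnerProductSpace ℝ E]
    [FiniteDimensional ℝ E] [MeasurableSpace E] [BorelSpace E] :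
    Integrable (fun x : E => Real.exp (-(2⁻¹ * ‖x‖ ^ 2))) := by
  have h := (GaussianFourier.integrable_cexp_neg_mul_sq_norm_add (V := E) (b := 2⁻¹)
    (by norm_num) 0 0).norm
  refine h.congr (ae_of_all _ fun x => ?_)
  simp only [Complex.norm_exp]
  congr 1
  have : (-2⁻¹ * (‖x‖ : ℂ) ^ 2 + 0 * ((inner ℝ 0 x : ℝ) : ℂ)) = ((-(2⁻¹ * ‖x‖ ^ 2) : ℝ) : ℂ) := by
    push_cast; ring
  rw [this, Complex.ofReal_re]

/-- Both measures have the same characteristic function. The value of `c` is left implicit because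
it cancels in the Bayes formula. -/
lemma stdGaussian_eq_withDensity {E : Type*} [NormedAddCommGroup E] [InnerProductSpace ℝ E]
    [FiniteDimensional ℝ E] [MeasurableSpace E] [BorelSpace E] :
    ∃ c : ℝ, 0 < c ∧ stdGaussian E =
      volume.withDensity fun x => ENNReal.ofReal (c * Real.exp (-(2⁻¹ * ‖x‖ ^ 2))) := by
  set I : ℝ := ∫ x : E, Real.exp (-(2⁻¹ * ‖x‖ ^ 2)) with hI
  have hIpos : 0 < I := integral_exp_pos integrable_exp_neg_sq_norm
  have key : ∀ t : E, ∫ x : E, Complex.exp (-2⁻¹ * (‖x‖ : ℂ) ^ 2 + Complex.I * ((inner ℝ t x : ℝ) : ℂ))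
      = I * Complex.exp (-(‖t‖ : ℂ) ^ 2 / 2) := by
    have h1 := fun (c : ℂ) (t : E) => GaussianFourier.integral_cexp_neg_mul_sq_norm_add
      (V := E) (b := 2⁻¹) (by norm_num) c t
    -- The case of zero frequency identifies the constant in the Fourier integral with `I`, so the
    -- power of `π` never has to be simplified.
    have h2 := h1 0 0
    simp only [zero_mul, add_zero, ne_eq, OfNat.ofNat_ne_zero, not_false_eq_true, zero_pow,
      zero_div, Complex.exp_zero, mul_one] at h2
    have h3 : (I : ℂ) = ∫ x : E, Complex.exp (-2⁻¹ * (‖x‖ : ℂ) ^ 2) := by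
      rw [hI, ← integral_complex_ofReal]
      congr 1
      ext x
      push_cast
      congr 1
      ring
    intro t
    rw [h1, ← h2, h3]
    congr 2
    rw [Complex.I_sq]
    ring
  refine ⟨I⁻¹, inv_pos.2 hIpos, ?_⟩
  have hmeas : Measurable fun x : E => ENNReal.ofReal (I⁻¹ * Real.exp (-(2⁻¹ * ‖x‖ ^ 2))) := by
    fun_prop
  have hfin : IsFiniteMeasure ((volume : Measure E).withDensity
      fun x => ENNReal.ofReal (I⁻¹ * Real.exp (-(2⁻¹ * ‖x‖ ^ 2)))) :=
    isFiniteMeasure_withDensity_ofReal (integrable_exp_neg_sq_norm.const_mul _).2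
  apply Measure.ext_of_charFun
  ext t
  rw [charFun_stdGaussian, charFun_apply,
    integral_withDensity_eq_integral_toReal_smul hmeas (by simp)]
  have : ∀ x : E, (ENNReal.ofReal (I⁻¹ * Real.exp (-(2⁻¹ * ‖x‖ ^ 2)))).toReal •
      Complex.exp ((inner ℝ x t : ℝ) * Complex.I) = (I : ℂ)⁻¹ *
        Complex.exp (-2⁻¹ * (‖x‖ : ℂ) ^ 2 + Complex.I * ((inner ℝ t x : ℝ) : ℂ)) := by
    intro x
    rw [ENNReal.toReal_ofReal (by positivity), Complex.real_smul, Complex.exp_add,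
      real_inner_comm, mul_comm Complex.I]
    push_cast
    rw [mul_assoc]
    congr 3
    ring_nf
  simp_rw [this]
  rw [integral_const_mul, key, ← mul_assoc, inv_mul_cancel₀, one_mul]
  exact_mod_cast hIpos.ne'

/-- The measure is the image of the standard Gaussian under `T = √S`. Since `√S S⁻¹ √S = 1`, the
quadratic form at `T x` is `‖x‖ ^ 2`, and a linear change of variables only contributes the Jacobian
`|det T|⁻¹`, absorbed in `c`. -/
lemma multivariateGaussian_eq_withDensity {N : ℕ} {S : Matrix (Fin N) (Fin N) ℝ}
    (hS : S.PosDef) : ∃ c : ℝ, 0 < c ∧ multivariateGaussian 0 S =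
      volume.withDensity fun x : Euc N =>
        ENNReal.ofReal (c * Real.exp (-(2⁻¹ * (x.ofLp ⬝ᵥ S⁻¹.mulVec x.ofLp)))) := by
  obtain ⟨c, hc, hstd⟩ := stdGaussian_eq_withDensity (E := Euc N)
  set R := CFC.sqrt S with hR
  have hRR : R * R = S := CFC.sqrt_mul_sqrt_self _ hS.posSemidef.nonneg
  have hRsymm : R.transpose = R := by
    have := (CFC.sqrt_nonneg S).isSelfAdjoint
    rwa [IsSelfAdjoint, Matrix.star_eq_conjTranspose, Matrix.conjTranspose_eq_transpose_of_trivial]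
      at this
  have hdet : R.det ≠ 0 := by
    intro h
    have := hS.det_pos
    rw [← hRR, Matrix.det_mul, h] at this
    simp at this
  have hunit : IsUnit R.det := isUnit_iff_ne_zero.2 hdet
  have hinv : R * (S⁻¹ * R) = 1 := by
    rw [← hRR, Matrix.mul_inv_rev, Matrix.mul_assoc, Matrix.nonsing_inv_mul _ hunit, mul_one,
      Matrix.mul_nonsing_inv _ hunit]
  set T := Matrix.toEuclideanCLM (𝕜 := ℝ) R with hT
  have hTapp : ∀ x : Euc N, (T x).ofLp = R.mulVec x.ofLp := fun x => by
    simp [hT]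
  have hq : ∀ x : Euc N, (T x).ofLp ⬝ᵥ S⁻¹.mulVec (T x).ofLp = ‖x‖ ^ 2 := by
    intro x
    rw [hTapp, Matrix.mulVec_mulVec, ← Matrix.vecMul_transpose R, hRsymm,
      ← Matrix.dotProduct_mulVec, Matrix.mulVec_mulVec, hinv, Matrix.one_mulVec,
      EuclideanSpace.real_norm_sq_eq, dotProduct]
    simp [sq]
  -- A kernel vector `x` of `T` would satisfy `‖x‖ ^ 2 = 0` by `hq`.
  have hTdet : LinearMap.det (T : Euc N →ₗ[ℝ] Euc N) ≠ 0 := by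
    intro h
    have hbot := LinearMap.bot_lt_ker_of_det_eq_zero h
    obtain ⟨x, hx, hx0⟩ := (Submodule.ne_bot_iff _).1 hbot.ne'
    have := hq x
    have hx' : T x = 0 := hx
    rw [hx'] at this
    simp at this
    exact hx0 (by simpa using this.symm)
  have hmap := Measure.map_linearMap_addHaar_eq_smul_addHaar (volume : Measure (Euc N)) hTdet
  set a : ℝ := |(LinearMap.det (T : Euc N →ₗ[ℝ] Euc N))⁻¹| with ha
  have hapos : 0 < a := abs_pos.2 (inv_ne_zero hTdet)
  refine ⟨a * c, mul_pos hapos hc, ?_⟩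
  set h : Euc N → ℝ := fun x => Real.exp (-(2⁻¹ * (x.ofLp ⬝ᵥ S⁻¹.mulVec x.ofLp))) with hh
  have hq' : ∀ x : Euc N, x.ofLp ⬝ᵥ S⁻¹.mulVec x.ofLp =
      ⟪x, Matrix.toEuclideanCLM (𝕜 := ℝ) S⁻¹ x⟫ := fun x => by
    rw [Matrix.inner_toEuclideanCLM]
  have hhm : Measurable h := by
    simp only [hh, hq']
    fun_prop
  have hTm : Measurable T := T.continuous.measurable
  have hgauss : multivariateGaussian 0 S = (stdGaussian (Euc N)).map T := by
    rw [multivariateGaussian]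
    congr 1
    ext1 x
    rw [zero_add]
  rw [hgauss, hstd]
  ext s hs
  have hm2 : Measurable fun x : Euc N => s.indicator (fun x => ENNReal.ofReal (c * h x)) x :=
    (by fun_prop : Measurable fun x => ENNReal.ofReal (c * h x)).indicator hs
  have hstep := lintegral_map (μ := volume) hm2 hTm
  have hmap' : Measure.map T (volume : Measure (Euc N)) = ENNReal.ofReal a • volume := hmap
  rw [hmap', lintegral_smul_measure, lintegral_indicator hs] at hstep
  rw [Measure.map_apply hTm hs, withDensity_apply _ (hTm hs), withDensity_apply _ hs,
    ← lintegral_indicator (hTm hs)]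
  calc _ = ∫⁻ x, s.indicator (fun x => ENNReal.ofReal (c * h x)) (T x) := by
        congr 1
        ext1 x
        by_cases hx : T x ∈ s
        · rw [Set.indicator_of_mem hx, Set.indicator_of_mem (by exact hx)]
          simp only [hh, hq]
        · rw [Set.indicator_of_notMem hx, Set.indicator_of_notMem (by exact hx)]
    _ = _ := by
        rw [← hstep, smul_eq_mul, ← lintegral_const_mul _ (by fun_prop)]
        congr 1
        ext1 x
        rw [← ENNReal.ofReal_mul hapos.le, mul_assoc]

/-! ### The Bayes formula -/

lemma integrable_exp_neg {Φ : Param → ℝ} (hm : Measurable Φ) (h0 : ∀ z, 0 ≤ Φ z) :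
    Integrable (fun z => Real.exp (-Φ z)) prior := by
  refine Integrable.of_bound (by fun_prop) 1 (ae_of_all _ fun z => ?_)
  rw [Real.norm_eq_abs, Real.abs_exp, Real.exp_le_one_iff]
  linarith [h0 z]

lemma normConst_pos {Φ : Param → ℝ} (hm : Measurable Φ) (h0 : ∀ z, 0 ≤ Φ z) :
    0 < normConst Φ :=
  integral_exp_pos (integrable_exp_neg hm h0)

lemma lintegral_exp_neg {Φ : Param → ℝ} (hm : Measurable Φ) (h0 : ∀ z, 0 ≤ Φ z) :
    ∫⁻ z, ENNReal.ofReal (Real.exp (-Φ z)) ∂prior = ENNReal.ofReal (normConst Φ) := by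
  rw [normConst, ofReal_integral_eq_lintegral_ofReal (integrable_exp_neg hm h0)
    (ae_of_all _ fun z => (Real.exp_pos _).le)]

lemma isProbabilityMeasure_bayesMeasure {Φ : Param → ℝ} (hm : Measurable Φ)
    (h0 : ∀ z, 0 ≤ Φ z) : IsProbabilityMeasure (bayesMeasure Φ) := by
  have hpos := normConst_pos hm h0
  refine ⟨?_⟩
  rw [bayesMeasure, withDensity_apply _ MeasurableSet.univ, Measure.restrict_univ]
  simp_rw [ENNReal.ofReal_div_of_pos hpos, div_eq_mul_inv]
  rw [lintegral_mul_const _ (by fun_prop), lintegral_exp_neg hm h0]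
  exact ENNReal.mul_inv_cancel (by simpa using hpos) ENNReal.ofReal_ne_top

lemma rnDeriv_bayesMeasure {Φ : Param → ℝ} (hm : Measurable Φ) :
    (bayesMeasure Φ).rnDeriv prior
      =ᵐ[prior] fun z => ENNReal.ofReal (Real.exp (-Φ z) / normConst Φ) :=
  Measure.rnDeriv_withDensity _ (by fun_prop)

/-! ### The Bayes formula as a Markov kernel, and disintegration -/

section Posterior

variable {E : Type*} [MeasurableSpace E]

/-- The Markov kernel `δ ↦ exp(-Φ(·, δ)) / Z(δ) · ρ`. -/
noncomputable def bayesKernel (Φ : E → Param → ℝ) : Kernel E Param :=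
  (Kernel.const E prior).withDensity fun δ z =>
    ENNReal.ofReal (Real.exp (-Φ δ z) / normConst (Φ δ))

lemma measurable_normConst {Φ : E → Param → ℝ} (hΦ : Measurable (Function.uncurry Φ)) :
    Measurable fun δ => normConst (Φ δ) := by
  have : StronglyMeasurable (Function.uncurry fun δ z => Real.exp (-Φ δ z)) :=
    (Real.measurable_exp.comp hΦ.neg).stronglyMeasurable
  exact this.integral_prod_right.measurable

lemma measurable_bayesDensity {Φ : E → Param → ℝ} (hΦ : Measurable (Function.uncurry Φ)) :
    Measurable (Function.uncurry fun δ z =>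
      ENNReal.ofReal (Real.exp (-Φ δ z) / normConst (Φ δ))) :=
  ((Real.measurable_exp.comp hΦ.neg).div
    ((measurable_normConst hΦ).comp measurable_fst)).ennreal_ofReal

lemma bayesKernel_apply {Φ : E → Param → ℝ} (hΦ : Measurable (Function.uncurry Φ)) (δ : E) :
    bayesKernel Φ δ = bayesMeasure (Φ δ) := by
  rw [bayesKernel, Kernel.withDensity_apply _ (measurable_bayesDensity hΦ), Kernel.const_apply,
    bayesMeasure]

lemma isMarkovKernel_bayesKernel {Φ : E → Param → ℝ} (hΦ : Measurable (Function.uncurry Φ))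
    (h0 : ∀ δ z, 0 ≤ Φ δ z) : IsMarkovKernel (bayesKernel Φ) :=
  ⟨fun δ => by
    rw [bayesKernel_apply hΦ]
    exact isProbabilityMeasure_bayesMeasure (hΦ.comp measurable_prodMk_left) (h0 δ)⟩

/-- If `(δ, z)` has density `c exp(-Φ(z, δ))` with respect to `μ ⊗ ρ`, then the Bayes formula is
the conditional law of `z` given `δ`. -/
lemma compProd_bayesKernel {Φ : E → Param → ℝ} (hΦ : Measurable (Function.uncurry Φ))
    (h0 : ∀ δ z, 0 ≤ Φ δ z) (μ : Measure E) [SigmaFinite μ] {c : ℝ} (hc : 0 < c) :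
    (μ.withDensity fun δ => ENNReal.ofReal (c * normConst (Φ δ))) ⊗ₘ bayesKernel Φ =
      (μ.prod prior).withDensity fun p => ENNReal.ofReal (c * Real.exp (-Φ p.1 p.2)) := by
  have := isMarkovKernel_bayesKernel hΦ h0
  have hZ := measurable_normConst hΦ
  have hZpos : ∀ δ, 0 < normConst (Φ δ) := fun δ =>
    normConst_pos (hΦ.comp measurable_prodMk_left) (h0 δ)
  have hd := measurable_bayesDensity hΦ
  have hc' : Measurable fun p : E × Param => ENNReal.ofReal (c * Real.exp (-Φ p.1 p.2)) :=
    ((Real.measurable_exp.comp hΦ.neg).const_mul c).ennreal_ofReal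
  ext s hs
  rw [Measure.compProd_apply hs, withDensity_apply _ hs, ← lintegral_indicator hs,
    lintegral_prod _ (hc'.indicator hs).aemeasurable,
    lintegral_withDensity_eq_lintegral_mul _ (by fun_prop)
      (Kernel.measurable_kernel_prodMk_left hs)]
  congr 1
  ext1 δ
  have hsδ : MeasurableSet (Prod.mk δ ⁻¹' s) := measurable_prodMk_left hs
  have hdδ : Measurable fun z => ENNReal.ofReal (Real.exp (-Φ δ z) / normConst (Φ δ)) :=
    hd.comp measurable_prodMk_left
  rw [Pi.mul_apply, bayesKernel_apply hΦ, bayesMeasure, withDensity_apply _ hsδ,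
    ← lintegral_const_mul _ hdδ, ← lintegral_indicator hsδ]
  congr 1
  ext1 z
  by_cases hz : (δ, z) ∈ s
  · rw [Set.indicator_of_mem (by exact hz), Set.indicator_of_mem hz,
      ← ENNReal.ofReal_mul (mul_pos hc (hZpos δ)).le]
    congr 1
    -- The marginal weight `c * normConst (Φ δ)` cancels the normalization of the kernel.
    have := (hZpos δ).ne'
    field_simp
  · rw [Set.indicator_of_notMem (by exact hz), Set.indicator_of_notMem hz]

end Posterior

/-! ### Conditional law of the parameter under additive noise -/

section AdditiveNoise

variable {E : Type*} [AddCommGroup E] [MeasureSpace E] [MeasurableAdd₂ E] [MeasurableSub₂ E]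
  [(volume : Measure E).IsAddLeftInvariant] [SigmaFinite (volume : Measure E)]

/-- The joint law of the datum `G(z) + ν` and the parameter `z`. -/
lemma map_datum_param {G : Param → E} (hG : Measurable G) {g : E → ℝ≥0∞} (hg : Measurable g)
    [SFinite (volume.withDensity g)] :
    (prior.prod (volume.withDensity g)).map (fun p => (G p.1 + p.2, p.1)) =
      (volume.prod prior).withDensity fun p => g (p.1 - G p.2) := by
  have hm : Measurable fun p : Param × E => (G p.1 + p.2, p.1) := by fun_prop
  have hgm : Measurable fun p : E × Param => g (p.1 - G p.2) := by fun_prop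
  ext s hs
  have hs1 : Measurable (s.indicator (1 : E × Param → ℝ≥0∞)) := measurable_one.indicator hs
  have hs2 : Measurable fun p : Param × E =>
      s.indicator (1 : E × Param → ℝ≥0∞) (G p.1 + p.2, p.1) := hs1.comp hm
  have hs3 : ∀ z, Measurable fun n : E =>
      s.indicator (1 : E × Param → ℝ≥0∞) (G z + n, z) := fun z =>
    hs1.comp (by fun_prop : Measurable fun n : E => (G z + n, z))
  rw [← lintegral_indicator_one hs, lintegral_map hs1 hm, lintegral_prod _ hs2.aemeasurable, ← lintegral_indicator_one hs,
    lintegral_withDensity_eq_lintegral_mul _ hgm hs1,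
    lintegral_prod_symm _ (hgm.mul hs1).aemeasurable]
  congr 1
  ext1 z
  rw [lintegral_withDensity_eq_lintegral_mul _ hg (hs3 z)]
  -- For fixed `z`, translation invariance replaces the noise `n` by the datum `x = G z + n`.
  refine Eq.trans ?_ (lintegral_add_left_eq_self (μ := volume)
    (fun x => g (x - G z) * s.indicator 1 (x, z)) (G z))
  simp [Pi.mul_apply]

/-- The Bayes formula gives the conditional law of the parameter given the noisy datum, and this
conditional law is unique for almost every datum. -/
lemma hasCondDistrib_bayesKernel {G : Param → E} (hG : Measurable G) {w : E → ℝ}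
    (hw : Measurable w) (hw0 : ∀ x, 0 ≤ w x) {c : ℝ} (hc : 0 < c) {γ : Measure E}
    (hγ : γ = volume.withDensity fun x => ENNReal.ofReal (c * Real.exp (-w x)))
    [IsProbabilityMeasure γ]
    {Ω : Type*} [MeasurableSpace Ω] (P : Measure Ω) [IsProbabilityMeasure P]
    {Z : Ω → Param} {ν : Ω → E} (hZ : HasLaw Z prior P) (hν : HasLaw ν γ P)
    (hind : IndepFun Z ν P) :
    HasCondDistrib Z (fun ω => G (Z ω) + ν ω) (bayesKernel fun δ z => w (δ - G z)) P ∧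
      ∀ η : Kernel E Param, IsMarkovKernel η →
        HasCondDistrib Z (fun ω => G (Z ω) + ν ω) η P →
        ∀ᵐ δ : E, η δ = bayesKernel (fun δ z => w (δ - G z)) δ := by
  set Φ : E → Param → ℝ := fun δ z => w (δ - G z) with hΦdef
  have hΦ : Measurable (Function.uncurry Φ) := by
    simp only [hΦdef, Function.uncurry_def]
    fun_prop
  have h0 : ∀ δ z, 0 ≤ Φ δ z := fun δ z => hw0 _
  have hK := isMarkovKernel_bayesKernel hΦ h0
  have hZm := hZ.aemeasurable
  have hνm := hν.aemeasurable
  have hprod : P.map (fun ω => (Z ω, ν ω)) = prior.prod γ := by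
    rw [(indepFun_iff_map_prod_eq_prod_map_map hZm hνm).1 hind, hZ.map_eq, hν.map_eq]
  have hjoint : P.map (fun ω => (G (Z ω) + ν ω, Z ω)) =
      (volume.prod prior).withDensity fun p => ENNReal.ofReal (c * Real.exp (-Φ p.1 p.2)) := by
    have : SFinite ((volume : Measure E).withDensity
        fun x => ENNReal.ofReal (c * Real.exp (-w x))) := by
      rw [← hγ]; infer_instance
    rw [← map_datum_param hG (g := fun x => ENNReal.ofReal (c * Real.exp (-w x)))
      (by fun_prop), ← hγ, ← hprod, AEMeasurable.map_map_of_aemeasurable (by fun_prop)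
        (hZm.prodMk hνm)]
    rfl
  have hYm : AEMeasurable (fun ω => G (Z ω) + ν ω) P := (hG.comp_aemeasurable hZm).add hνm
  rw [← compProd_bayesKernel hΦ h0 volume hc] at hjoint
  have hY : P.map (fun ω => G (Z ω) + ν ω) =
      volume.withDensity fun δ => ENNReal.ofReal (c * normConst (Φ δ)) := by
    rw [← Measure.fst_map_prodMk₀ (Y := Z) hZm, hjoint, Measure.fst_compProd]
  have hpost : HasCondDistrib Z (fun ω => G (Z ω) + ν ω) (bayesKernel Φ) P :=
    ⟨hYm.prodMk hZm, by rw [hY, hjoint]⟩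
  refine ⟨hpost, fun η hη h => ?_⟩
  have : IsProbabilityMeasure (P.map fun ω => G (Z ω) + ν ω) :=
    Measure.isProbabilityMeasure_map hYm
  have hae := Kernel.ae_eq_of_compProd_eq (h.map_eq.symm.trans hpost.map_eq)
  rw [hY] at hae
  -- Null sets for the law of the datum are Lebesgue null, because its density `c * normConst (Φ δ)`
  -- vanishes nowhere.
  refine Measure.AbsolutelyContinuous.ae_le
    (withDensity_absolutelyContinuous' ?_ ?_) hae
  · exact ((measurable_normConst hΦ).const_mul c).ennreal_ofReal.aemeasurable
  · refine ae_of_all _ fun δ => ?_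
    have : 0 < normConst (Φ δ) := normConst_pos (hΦ.comp measurable_prodMk_left) (h0 δ)
    simpa using mul_pos hc this

end AdditiveNoise

end TwoScale

namespace TwoScale
open scoped ENNReal RealInnerProductSpace

/-! ### Hellinger distance of Bayes measures -/

lemma abs_exp_sub_exp_le {a b M : ℝ} (ha : a ≤ M) (hb : b ≤ M) :
    |Real.exp a - Real.exp b| ≤ Real.exp M * |a - b| := by
  wlog h : b ≤ a generalizing a b
  · rw [abs_sub_comm, abs_sub_comm a]
    exact this hb ha (le_of_not_ge h)
  rw [abs_of_nonneg (sub_nonneg.2 (Real.exp_le_exp.2 h)), abs_of_nonneg (sub_nonneg.2 h)]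
  have h1 : Real.exp b = Real.exp a * Real.exp (b - a) := by rw [← Real.exp_add]; ring_nf
  have h2 := Real.add_one_le_exp (b - a)
  calc Real.exp a - Real.exp b = Real.exp a * (1 - Real.exp (b - a)) := by rw [h1]; ring
    _ ≤ Real.exp a * (a - b) := mul_le_mul_of_nonneg_left (by linarith) (Real.exp_pos a).le
    _ ≤ Real.exp M * (a - b) := by gcongr

lemma log_normConst_le {Φ Φ' : Param → ℝ} (hm : Measurable Φ) (hm' : Measurable Φ')
    (h0 : ∀ z, 0 ≤ Φ z) (h0' : ∀ z, 0 ≤ Φ' z) {η : ℝ} (h : ∀ z, |Φ z - Φ' z| ≤ η) :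
    Real.log (normConst Φ) ≤ η + Real.log (normConst Φ') := by
  have hZ' := normConst_pos hm' h0'
  have : normConst Φ ≤ Real.exp η * normConst Φ' := by
    rw [normConst, normConst, ← integral_const_mul]
    refine integral_mono (integrable_exp_neg hm h0) ((integrable_exp_neg hm' h0').const_mul _)
      fun z => ?_
    change Real.exp (-Φ z) ≤ Real.exp η * Real.exp (-Φ' z)
    rw [← Real.exp_add]
    exact Real.exp_le_exp.2 (by linarith [abs_le.1 (h z)])
  calc _ ≤ Real.log (Real.exp η * normConst Φ') :=
        Real.log_le_log (normConst_pos hm h0) this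
    _ = _ := by rw [Real.log_mul (Real.exp_pos _).ne' hZ'.ne', Real.log_exp]

lemma sqrt_bayesDensity {Φ : Param → ℝ} (hm : Measurable Φ) (h0 : ∀ z, 0 ≤ Φ z) (z : Param) :
    √(ENNReal.ofReal (Real.exp (-Φ z) / normConst Φ)).toReal =
      Real.exp (-(Φ z + Real.log (normConst Φ)) / 2) := by
  have hZ := normConst_pos hm h0
  rw [ENNReal.toReal_ofReal (by positivity), Real.exp_half, neg_add, Real.exp_add,
    Real.exp_neg (Real.log _), Real.exp_log hZ, div_eq_mul_inv]

/-- The root densities are `exp(-(Φ + log Z)/2)`. From `Φ ≥ 0` and `Z ≥ exp(-K)` the exponents are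
at most `K / 2`. They differ by at most `η`, since `Φ` and `log Z` each move by at most `η` and the
sum is halved. So the integrand is at most `(exp(K/2) η) ^ 2`; the factor `1/2` of the distance is
given away. -/
lemma hellingerDist_bayesMeasure_le {Φ Φ' : Param → ℝ} (hm : Measurable Φ) (hm' : Measurable Φ')
    (h0 : ∀ z, 0 ≤ Φ z) (h0' : ∀ z, 0 ≤ Φ' z) {K : ℝ} (hK : ∀ z, Φ z ≤ K) (hK' : ∀ z, Φ' z ≤ K)
    {η : ℝ} (h : ∀ z, |Φ z - Φ' z| ≤ η) :
    hellingerDist (bayesMeasure Φ) (bayesMeasure Φ') ≤ Real.exp (K / 2) * η := by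
  obtain ⟨z₀⟩ : Nonempty Param := ⟨fun _ => ⟨0, by norm_num, by norm_num⟩⟩
  have hη : 0 ≤ η := (abs_nonneg _).trans (h z₀)
  have hlow : ∀ {Ψ : Param → ℝ}, Measurable Ψ → (∀ z, 0 ≤ Ψ z) → (∀ z, Ψ z ≤ K) →
      -K ≤ Real.log (normConst Ψ) := by
    intro Ψ hΨ hΨ0 hΨK
    rw [Real.le_log_iff_exp_le (normConst_pos hΨ hΨ0), normConst]
    calc Real.exp (-K) = ∫ _, Real.exp (-K) ∂prior := by simp
      _ ≤ _ := integral_mono (integrable_const _) (integrable_exp_neg hΨ hΨ0)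
        fun z => Real.exp_le_exp.2 (neg_le_neg (hΨK z))
  have hl := log_normConst_le hm hm' h0 h0' h
  have hl' := log_normConst_le hm' hm h0' h0 (η := η) fun z => by rw [abs_sub_comm]; exact h z
  rw [hellingerDist]
  refine Real.sqrt_le_iff.2 ⟨by positivity, ?_⟩
  have hcongr : ∫ z, (√(((bayesMeasure Φ).rnDeriv prior z).toReal) -
        √(((bayesMeasure Φ').rnDeriv prior z).toReal)) ^ 2 ∂prior =
      ∫ z, (Real.exp (-(Φ z + Real.log (normConst Φ)) / 2) -
        Real.exp (-(Φ' z + Real.log (normConst Φ')) / 2)) ^ 2 ∂prior := by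
    refine integral_congr_ae ?_
    filter_upwards [rnDeriv_bayesMeasure hm, rnDeriv_bayesMeasure hm'] with z hz hz'
    rw [hz, hz', sqrt_bayesDensity hm h0, sqrt_bayesDensity hm' h0']
  rw [hcongr]
  have hbound := norm_integral_le_of_norm_le_const (μ := prior)
    (f := fun z => (Real.exp (-(Φ z + Real.log (normConst Φ)) / 2) -
        Real.exp (-(Φ' z + Real.log (normConst Φ')) / 2)) ^ 2)
    (C := (Real.exp (K / 2) * η) ^ 2) (ae_of_all _ fun z => by
      rw [Real.norm_eq_abs, abs_pow]
      gcongr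
      have hLΦ := hlow hm h0 hK
      have hLΦ' := hlow hm' h0' hK'
      refine (abs_exp_sub_exp_le (M := K / 2) (by linarith [h0 z]) (by linarith [h0' z])).trans ?_
      gcongr
      have := abs_le.1 (h z)
      rw [abs_le]
      constructor <;> linarith)
  have := (Real.le_norm_self _).trans hbound
  simp only [probReal_univ, mul_one] at this
  nlinarith [sq_nonneg (Real.exp (K / 2) * η)]

end TwoScale

namespace TwoScale
open scoped ENNReal RealInnerProductSpace Topology

/-! ### Bounds for periodic functions and for the coefficient -/

lemma closure_unitCube (d : ℕ) : closure (unitCube d) = {y | ∀ i, y i ∈ Set.Icc (0 : ℝ) 1} := by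
  have h : unitCube d =
      (EuclideanSpace.equiv (Fin d) ℝ).toHomeomorph ⁻¹' Set.univ.pi fun _ => Set.Ioo (0 : ℝ) 1 := by
    ext y
    simp [unitCube]
  rw [h, ← Homeomorph.preimage_closure, closure_pi_set]
  ext y
  simp [closure_Ioo (zero_ne_one' ℝ), Pi.le_def, forall_and]

lemma isCompact_closure_unitCube (d : ℕ) : IsCompact (closure (unitCube d)) := by
  have h : closure (unitCube d) =
      (EuclideanSpace.equiv (Fin d) ℝ).toHomeomorph ⁻¹' Set.univ.pi fun _ => Set.Icc (0 : ℝ) 1 := by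
    rw [closure_unitCube]
    ext y
    simp [Pi.le_def, forall_and]
  rw [h]
  exact (Homeomorph.isCompact_preimage _).2 (isCompact_univ_pi fun _ => isCompact_Icc)

namespace IsContPeriodic

variable {d : ℕ} {D : Set (Euc d)}

/-- Every value of a periodic function is attained on the closed unit cube. -/
lemma exists_mem_closure_unitCube {F : Type*} [TopologicalSpace F] {g : Euc d → Euc d → F}
    (hg : IsContPeriodic D g) {x : Euc d} (hx : x ∈ closure D) (y : Euc d) :
    ∃ y' ∈ closure (unitCube d), g x y' = g x y := by
  -- The periods of `g x` form a subgroup containing the basis vectors, hence all integer vectors;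
  -- `y` can then be replaced by its fractional parts.
  let H : AddSubgroup (Euc d) :=
    { carrier := {v | ∀ y, g x (y + v) = g x y}
      zero_mem' := fun y => by rw [add_zero]
      add_mem' := fun {v w} hv hw y => by rw [← add_assoc, hw, hv]
      neg_mem' := fun {v} hv y => by rw [← hv (y + -v), neg_add_cancel_right] }
  have hv : -∑ i, ⌊y i⌋ • EuclideanSpace.single i (1 : ℝ) ∈ H :=
    H.neg_mem (H.sum_mem fun i _ => H.zsmul_mem (fun y => hg.periodic x hx y i) _)
  refine ⟨y + -∑ i, ⌊y i⌋ • EuclideanSpace.single i (1 : ℝ), ?_, hv y⟩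
  rw [closure_unitCube]
  intro i
  have : (y + -∑ i, ⌊y i⌋ • EuclideanSpace.single i (1 : ℝ)) i = Int.fract (y i) := by
    simp [Int.fract, Pi.single_apply, sub_eq_add_neg]
  rw [this]
  exact ⟨Int.fract_nonneg _, (Int.fract_lt_one _).le⟩

/-- Continuity carries a closed condition to the closure of `D × Y`, and periodicity carries it to
every `y`. This is how an infimum or supremum over the open cell controls the values at `x/ε`,
whatever `ε` is. -/
lemma mem_of_isClosed {F : Type*} [TopologicalSpace F] {g : Euc d → Euc d → F}
    (hg : IsContPeriodic D g) {C : Set F} (hC : IsClosed C)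
    (h : ∀ x ∈ D, ∀ y ∈ unitCube d, g x y ∈ C) {x : Euc d} (hx : x ∈ closure D) (y : Euc d) :
    g x y ∈ C := by
  obtain ⟨y', hy', hgy⟩ := hg.exists_mem_closure_unitCube hx y
  rw [← hgy]
  have hcl : closure (D ×ˢ unitCube d) ⊆ closure D ×ˢ Set.univ := by
    rw [closure_prod_eq]
    exact Set.prod_mono le_rfl (Set.subset_univ _)
  have hmaps : Set.MapsTo (fun p : Euc d × Euc d => g p.1 p.2) (D ×ˢ unitCube d) C :=
    fun p hp => h _ hp.1 _ hp.2
  have := hmaps.closure_of_continuousOn (hg.continuousOn.mono hcl)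
  rw [hC.closure_eq, closure_prod_eq] at this
  exact this (⟨hx, hy'⟩ : (x, y') ∈ closure D ×ˢ closure (unitCube d))

lemma exists_bound {F : Type*} [NormedAddCommGroup F] {g : Euc d → Euc d → F}
    (hg : IsContPeriodic D g) (hD : Bornology.IsBounded D) :
    ∃ M, ∀ x ∈ closure D, ∀ y, ‖g x y‖ ≤ M := by
  obtain ⟨M, hM⟩ := ((hD.isCompact_closure).prod
    (isCompact_closure_unitCube d)).exists_bound_of_continuousOn
      (hg.continuousOn.mono (Set.prod_mono le_rfl (Set.subset_univ _)))
  refine ⟨M, fun x hx y => ?_⟩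
  obtain ⟨y', hy', hgy⟩ := hg.exists_mem_closure_unitCube hx y
  rw [← hgy]
  exact hM (x, y') ⟨hx, hy'⟩

lemma cellInf_le {g : Euc d → Euc d → ℝ} (hg : IsContPeriodic D g) (hD : Bornology.IsBounded D)
    {x : Euc d} (hx : x ∈ closure D) (y : Euc d) : cellInf D g ≤ g x y := by
  obtain ⟨M, hM⟩ := hg.exists_bound hD
  refine hg.mem_of_isClosed (isClosed_Ici (a := cellInf D g)) (fun x hx y hy => ?_) hx y
  refine csInf_le ⟨-M, ?_⟩ ⟨(x, y), ⟨hx, hy⟩, rfl⟩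
  rintro _ ⟨p, hp, rfl⟩
  exact (abs_le.1 (hM _ (subset_closure hp.1) p.2)).1

lemma abs_le_cellSupAbs {g : Euc d → Euc d → ℝ} (hg : IsContPeriodic D g)
    (hD : Bornology.IsBounded D) {x : Euc d} (hx : x ∈ closure D) (y : Euc d) :
    |g x y| ≤ cellSupAbs D g := by
  obtain ⟨M, hM⟩ := hg.exists_bound hD
  refine hg.mem_of_isClosed (C := {t | |t| ≤ cellSupAbs D g})
    (isClosed_le continuous_abs continuous_const) (fun x hx y hy => ?_) hx y
  refine le_csSup ⟨M, ?_⟩ ⟨(x, y), ⟨hx, hy⟩, rfl⟩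
  rintro _ ⟨p, hp, rfl⟩
  exact hM _ (subset_closure hp.1) p.2

lemma continuousOn_oscillating {F : Type*} [TopologicalSpace F] {g : Euc d → Euc d → F}
    (hg : IsContPeriodic D g) (t : ℝ) : ContinuousOn (fun x => g x (t • x)) (closure D) :=
  hg.continuousOn.comp (f := fun x : Euc d => (x, t • x)) (by fun_prop) fun _ hx => ⟨hx, trivial⟩

end IsContPeriodic

lemma cellSupAbs_nonneg {d : ℕ} (D : Set (Euc d)) (g : Euc d → Euc d → ℝ) :
    0 ≤ cellSupAbs D g :=
  Real.sSup_nonneg <| by rintro _ ⟨p, -, rfl⟩; exact abs_nonneg _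

lemma abs_param_le (z : Param) (j : ℕ) : |(z j : ℝ)| ≤ 1 := abs_le.2 (z j).2

/-- The weighted distance `∑_j |z_j - z'_j| s_j` of two parameters. -/
noncomputable def paramDist (s : ℕ → ℝ) (z z' : Param) : ℝ := ∑' j, |(z j : ℝ) - z' j| * s j

lemma paramDist_term_le {s : ℕ → ℝ} (h0 : ∀ j, 0 ≤ s j) (z z' : Param) (j : ℕ) :
    ‖|(z j : ℝ) - z' j| * s j‖ ≤ 2 * s j := by
  rw [Real.norm_eq_abs, abs_mul, abs_abs, abs_of_nonneg (h0 j)]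
  have := abs_sub (z j : ℝ) (z' j)
  exact mul_le_mul_of_nonneg_right
    (by linarith [abs_param_le z j, abs_param_le z' j]) (h0 j)

lemma paramDist_nonneg {s : ℕ → ℝ} (h0 : ∀ j, 0 ≤ s j) (z z' : Param) : 0 ≤ paramDist s z z' :=
  tsum_nonneg fun j => mul_nonneg (abs_nonneg _) (h0 j)

/-- Each term depends continuously on one coordinate and is dominated by `2 * s j`, so the series
converges uniformly and is continuous for the product topology. -/
lemma tendsto_paramDist {s : ℕ → ℝ} (h0 : ∀ j, 0 ≤ s j) (hs : Summable s) (z : Param) :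
    Filter.Tendsto (fun z' => paramDist s z' z) (𝓝 z) (𝓝 0) := by
  have hc : Continuous fun z' => paramDist s z' z :=
    continuous_tsum (fun j => by fun_prop) (hs.mul_left 2) fun j z' => paramDist_term_le h0 z' z j
  have := hc.tendsto z
  simpa [paramDist] using this

/-! ### Ellipticity of the coefficient and its dependence on the parameter -/

section Coeff

variable {d : ℕ} {D : Set (Euc d)} {Abar : Euc d → Euc d → ℝ} {ψ : ℕ → Euc d → Euc d → ℝ}

lemma norm_coeff_term_le (hD : Bornology.IsBounded D) (hψ : ∀ j, IsContPeriodic D (ψ j))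
    (z : Param) {x : Euc d} (hx : x ∈ closure D) (y : Euc d) (j : ℕ) :
    ‖(z j : ℝ) * ψ j x y‖ ≤ cellSupAbs D (ψ j) := by
  rw [norm_mul]
  have h1 : ‖(z j : ℝ)‖ ≤ 1 := abs_param_le z j
  have h2 : ‖ψ j x y‖ ≤ cellSupAbs D (ψ j) := (hψ j).abs_le_cellSupAbs hD hx y
  calc _ ≤ 1 * ‖ψ j x y‖ := by gcongr
    _ ≤ _ := by rwa [one_mul]

lemma abs_coeff_sub_le (hD : Bornology.IsBounded D) (hψ : ∀ j, IsContPeriodic D (ψ j))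
    (hsum : Summable fun j => cellSupAbs D (ψ j)) (z : Param) {x : Euc d} (hx : x ∈ closure D)
    (y : Euc d) : |coeff Abar ψ z x y - Abar x y| ≤ ∑' j, cellSupAbs D (ψ j) := by
  rw [coeff, add_sub_cancel_left]
  exact tsum_of_norm_bounded hsum.hasSum (norm_coeff_term_le hD hψ z hx y)

/-- The fluctuation removes at most the fraction `κ/(1+κ)` of the infimum of `Abar`, which leaves
`1/(1+κ)` of it. -/
lemma le_coeff (hD : Bornology.IsBounded D) (hAbar : IsContPeriodic D Abar)
    (hψ : ∀ j, IsContPeriodic D (ψ j)) (hsum : Summable fun j => cellSupAbs D (ψ j))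
    {κ : ℝ} (hκ : 0 < κ) (hassum : ∑' j, cellSupAbs D (ψ j) ≤ κ / (1 + κ) * cellInf D Abar)
    (z : Param) {x : Euc d} (hx : x ∈ closure D) (y : Euc d) :
    cellInf D Abar / (1 + κ) ≤ coeff Abar ψ z x y := by
  have h1 := (abs_le.1 (abs_coeff_sub_le (Abar := Abar) hD hψ hsum z hx y)).1
  have h2 := hAbar.cellInf_le hD hx y
  have h3 : cellInf D Abar / (1 + κ) = cellInf D Abar - κ / (1 + κ) * cellInf D Abar := by
    field_simp
    ring
  linarith

lemma continuousOn_coeff (hD : Bornology.IsBounded D) (hAbar : IsContPeriodic D Abar)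
    (hψ : ∀ j, IsContPeriodic D (ψ j)) (hsum : Summable fun j => cellSupAbs D (ψ j))
    (z : Param) (t : ℝ) : ContinuousOn (fun x => coeff Abar ψ z x (t • x)) (closure D) :=
  (hAbar.continuousOn_oscillating t).add <| continuousOn_tsum
    (fun j => continuousOn_const.mul ((hψ j).continuousOn_oscillating t)) hsum
    fun j x hx => norm_coeff_term_le hD hψ z hx (t • x) j

lemma abs_coeff_sub_coeff_le (hD : Bornology.IsBounded D) (hψ : ∀ j, IsContPeriodic D (ψ j))
    (hsum : Summable fun j => cellSupAbs D (ψ j)) (z z' : Param) {x : Euc d}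
    (hx : x ∈ closure D) (y : Euc d) :
    |coeff Abar ψ z x y - coeff Abar ψ z' x y| ≤
      paramDist (fun j => cellSupAbs D (ψ j)) z z' := by
  have hs : ∀ z : Param, Summable fun j => (z j : ℝ) * ψ j x y := fun z =>
    Summable.of_norm_bounded hsum (norm_coeff_term_le hD hψ z hx y)
  have h0 := fun j => cellSupAbs_nonneg D (ψ j)
  rw [coeff, coeff, add_sub_add_left_eq_sub, ← (hs z).tsum_sub (hs z')]
  have hd : Summable fun j => |(z j : ℝ) - z' j| * cellSupAbs D (ψ j) :=
    Summable.of_norm_bounded (hsum.mul_left 2) (paramDist_term_le h0 z z')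
  rw [← Real.norm_eq_abs]
  refine tsum_of_norm_bounded hd.hasSum fun j => ?_
  rw [← sub_mul, norm_mul]
  exact mul_le_mul_of_nonneg_left ((hψ j).abs_le_cellSupAbs hD hx y) (abs_nonneg _)

end Coeff

end TwoScale

namespace TwoScale
open scoped ENNReal ContDiff RealInnerProductSpace Topology

/-! ### The Poincaré inequality -/

section Poincare

variable {d : ℕ}

lemma norm_gradient_eq (φ : Euc d → ℝ) (x : Euc d) : ‖gradient φ x‖ = ‖fderiv ℝ φ x‖ := by
  simp [gradient]

/-- Integration by parts of `φ² · 1`, with `1` written as the `i`-th derivative of the coordinate `x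
i`. -/
lemma integral_sq_eq_neg_integral_coord_mul (i : Fin d) {φ : Euc d → ℝ} (hφ : ContDiff ℝ ∞ φ)
    (hc : HasCompactSupport φ) :
    ∫ x, φ x ^ 2 = -∫ x, 2 * φ x * fderiv ℝ φ x (EuclideanSpace.single i 1) * x i := by
  have hφd : Differentiable ℝ φ := hφ.differentiable (by simp)
  have hφc : Continuous φ := hφ.continuous
  have hfd : Continuous (fderiv ℝ φ) := hφ.continuous_fderiv (by simp)
  have hsq : ∀ x, fderiv ℝ (fun x => φ x ^ 2) x (EuclideanSpace.single i 1) =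
      2 * φ x * fderiv ℝ φ x (EuclideanSpace.single i 1) := by
    intro x
    rw [((hφd x).hasFDerivAt.pow 2).fderiv]
    simp
  have hproj : ∀ x : Euc d, fderiv ℝ (fun x : Euc d => x i) x (EuclideanSpace.single i 1) = 1 := by
    intro x
    have : HasFDerivAt (fun x : Euc d => x i) (EuclideanSpace.proj i : Euc d →L[ℝ] ℝ) x :=
      (EuclideanSpace.proj i : Euc d →L[ℝ] ℝ).hasFDerivAt
    rw [this.fderiv]
    simp
  have hint : ∀ g : Euc d → ℝ, Continuous g → (∀ x, φ x = 0 → g x = 0) → Integrable g :=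
    fun g hg h0 => hg.integrable_of_hasCompactSupport <|
      HasCompactSupport.intro hc fun x hx => h0 x (image_eq_zero_of_notMem_tsupport hx)
  have h1 : Integrable fun x : Euc d =>
      fderiv ℝ (fun x => φ x ^ 2) x (EuclideanSpace.single i 1) * x i := by
    simp_rw [hsq]
    exact hint _ (by fun_prop) fun x hx => by simp [hx]
  have h2 : Integrable fun x : Euc d =>
      φ x ^ 2 * fderiv ℝ (fun x : Euc d => x i) x (EuclideanSpace.single i 1) := by
    simp_rw [hproj]
    exact hint _ (by fun_prop) fun x hx => by simp [hx]
  have h3 : Integrable fun x : Euc d => φ x ^ 2 * x i :=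
    hint _ (by fun_prop) fun x hx => by simp [hx]
  have hibp := integral_mul_fderiv_eq_neg_fderiv_mul_of_integrable h1 h2 h3
    (fun x _ => (hφd x).pow 2) (fun x _ => by fun_prop)
  simpa only [hproj, hsq, mul_one] using hibp

lemma integral_sq_le_integral_sq_norm_fderiv (i : Fin d) {φ : Euc d → ℝ} (hφ : ContDiff ℝ ∞ φ)
    (hc : HasCompactSupport φ) {R : ℝ} (hR : ∀ x ∈ tsupport φ, ‖x‖ ≤ R) :
    ∫ x, φ x ^ 2 ≤ 4 * R ^ 2 * ∫ x, ‖fderiv ℝ φ x‖ ^ 2 := by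
  have hφc : Continuous φ := hφ.continuous
  have hfd : Continuous (fderiv ℝ φ) := hφ.continuous_fderiv (by simp)
  have hint : ∀ g : Euc d → ℝ, Continuous g → (∀ x, x ∉ tsupport φ → g x = 0) → Integrable g :=
    fun g hg h0 => hg.integrable_of_hasCompactSupport <| HasCompactSupport.intro hc fun x => h0 x
  have hφ0 : ∀ x, x ∉ tsupport φ → φ x = 0 := fun x => image_eq_zero_of_notMem_tsupport
  have hfd0 : ∀ x, x ∉ tsupport φ → fderiv ℝ φ x = 0 := fun x hx =>
    image_eq_zero_of_notMem_tsupport fun h => hx (tsupport_fderiv_subset ℝ h)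
  have hint1 : Integrable fun x => φ x ^ 2 := hint _ (by fun_prop) fun x hx => by simp [hφ0 x hx]
  have hint2 : Integrable fun x => ‖fderiv ℝ φ x‖ ^ 2 :=
    hint _ (by fun_prop) fun x hx => by simp [hfd0 x hx]
  have hint3 : Integrable fun x : Euc d =>
      -(2 * φ x * fderiv ℝ φ x (EuclideanSpace.single i 1) * x i) :=
    hint _ (by fun_prop) fun x hx => by simp [hφ0 x hx]
  -- Young's inequality, weighted so that half of `∫ φ²` can be absorbed on the left; doubling what
  -- remains gives the factor `4 * R ^ 2`.
  have hpt : ∀ x, -(2 * φ x * fderiv ℝ φ x (EuclideanSpace.single i 1) * x i) ≤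
      2⁻¹ * φ x ^ 2 + 2 * R ^ 2 * ‖fderiv ℝ φ x‖ ^ 2 := by
    intro x
    by_cases hx : x ∈ tsupport φ
    · have h1 : |x i| ≤ R := (PiLp.norm_apply_le x i).trans (hR x hx)
      have h2 : |fderiv ℝ φ x (EuclideanSpace.single i 1)| ≤ ‖fderiv ℝ φ x‖ := by
        simpa using (fderiv ℝ φ x).le_opNorm (EuclideanSpace.single i 1)
      have h3 : |fderiv ℝ φ x (EuclideanSpace.single i 1) * x i| ^ 2 ≤
          (‖fderiv ℝ φ x‖ * R) ^ 2 := by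
        rw [abs_mul]
        gcongr
      rw [sq_abs] at h3
      nlinarith [sq_nonneg (φ x + 2 * (fderiv ℝ φ x (EuclideanSpace.single i 1) * x i))]
    · rw [hφ0 x hx]
      simp only [mul_zero, zero_mul, neg_zero]
      positivity
  have hmono : ∫ x, φ x ^ 2 ≤ ∫ x, (2⁻¹ * φ x ^ 2 + 2 * R ^ 2 * ‖fderiv ℝ φ x‖ ^ 2) := by
    rw [integral_sq_eq_neg_integral_coord_mul i hφ hc, ← integral_neg]
    exact integral_mono hint3 ((hint1.const_mul _).add (hint2.const_mul _)) hpt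
  rw [integral_add (hint1.const_mul _) (hint2.const_mul _), integral_const_mul,
    integral_const_mul] at hmono
  linarith

lemma Lp_two_norm_sq {α F : Type*} [MeasurableSpace α] {μ : Measure α} [NormedAddCommGroup F]
    [InnerProductSpace ℝ F] (p : Lp F 2 μ) : ‖p‖ ^ 2 = ∫ x, ‖p x‖ ^ 2 ∂μ := by
  rw [← real_inner_self_eq_norm_sq, L2.inner_def]
  simp only [real_inner_self_eq_norm_sq]

/-- The inequality is a closed condition on pairs, so it passes from test functions to their
closure. Positivity of `d` supplies the coordinate used in the integration by parts. -/
lemma exists_poincare {D : Set (Euc d)} (hd : 0 < d) (hD : Bornology.IsBounded D) :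
    ∃ C, 0 ≤ C ∧ ∀ u : H10 D, ‖(u : FunGradPairs D).fst‖ ≤ C * ‖(u : FunGradPairs D).snd‖ := by
  obtain ⟨R, hR0, hR⟩ := hD.exists_pos_norm_le
  refine ⟨2 * R, by positivity, fun u => ?_⟩
  have hcl : IsClosed {w : FunGradPairs D | ‖w.fst‖ ≤ 2 * R * ‖w.snd‖} := by
    refine isClosed_le ?_ ?_
    · exact (WithLp.prod_continuous_ofLp _ _ _).fst.norm
    · exact continuous_const.mul (WithLp.prod_continuous_ofLp _ _ _).snd.norm
  refine closure_minimal (s := (testPairs D : Set (FunGradPairs D))) ?_ hcl u.2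
  rintro w ⟨φ, h1, h2, h3, h4, h5⟩
  have hsq : ‖w.fst‖ ^ 2 ≤ (2 * R * ‖w.snd‖) ^ 2 := by
    rw [mul_pow, Lp_two_norm_sq, Lp_two_norm_sq]
    have e1 : ∫ x in D, ‖w.fst x‖ ^ 2 = ∫ x, φ x ^ 2 := by
      rw [← setIntegral_eq_integral_of_forall_compl_eq_zero (s := D)
        (f := fun x => φ x ^ 2)]
      · refine integral_congr_ae ?_
        filter_upwards [h4] with x hx
        rw [hx, Real.norm_eq_abs, sq_abs]
      · intro x hx
        rw [image_eq_zero_of_notMem_tsupport fun h => hx (h3 h), sq, mul_zero]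
    have e2 : ∫ x in D, ‖w.snd x‖ ^ 2 = ∫ x, ‖fderiv ℝ φ x‖ ^ 2 := by
      rw [← setIntegral_eq_integral_of_forall_compl_eq_zero (s := D)
        (f := fun x => ‖fderiv ℝ φ x‖ ^ 2)]
      · refine integral_congr_ae ?_
        filter_upwards [h5] with x hx
        rw [hx, norm_gradient_eq]
      · intro x hx
        rw [image_eq_zero_of_notMem_tsupport fun h => hx (h3 (tsupport_fderiv_subset ℝ h)),
          norm_zero, sq, mul_zero]
    rw [e1, e2]
    have := integral_sq_le_integral_sq_norm_fderiv ⟨0, hd⟩ h1 h2 fun x hx => hR x (h3 hx)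
    linarith [this]
  exact (sq_le_sq₀ (norm_nonneg _) (by positivity)).1 hsq

lemma exists_norm_le_norm_grad {D : Set (Euc d)} (hd : 0 < d) (hD : Bornology.IsBounded D) :
    ∃ C, 0 < C ∧ ∀ u : H10 D, ‖u‖ ≤ C * ‖(u : FunGradPairs D).snd‖ := by
  obtain ⟨C, hC0, hC⟩ := exists_poincare hd hD
  refine ⟨C + 1, by positivity, fun u => ?_⟩
  have h := hC u
  refine (sq_le_sq₀ (norm_nonneg _) (by positivity)).1 ?_
  rw [Submodule.coe_norm, WithLp.prod_norm_sq_eq_of_L2]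
  have : ‖(u : FunGradPairs D).fst‖ ^ 2 ≤ (C * ‖(u : FunGradPairs D).snd‖) ^ 2 := by gcongr
  nlinarith [norm_nonneg (u : FunGradPairs D).snd, sq_nonneg ‖(u : FunGradPairs D).snd‖]

end Poincare

end TwoScale

namespace TwoScale
open scoped ENNReal ContDiff RealInnerProductSpace Topology

/-! ### The forward problem -/

/-! ### Bilinear forms on L² with a bounded weight -/

section WeightedInner

variable {α F : Type*} [MeasurableSpace α] {μ : Measure α} [NormedAddCommGroup F]
  [InnerProductSpace ℝ F] {a b : α → ℝ} {M m : ℝ}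

lemma integrable_mul_inner (ha : AEStronglyMeasurable a μ) (hM : ∀ᵐ x ∂μ, ‖a x‖ ≤ M)
    (p q : Lp F 2 μ) : Integrable (fun x => a x * ⟪p x, q x⟫) μ :=
  (L2.integrable_inner (𝕜 := ℝ) p q).bdd_mul ha hM

lemma abs_integral_mul_inner_le (ha : AEStronglyMeasurable a μ)
    (hM : ∀ᵐ x ∂μ, ‖a x‖ ≤ M) (p q : Lp F 2 μ) :
    |∫ x, a x * ⟪p x, q x⟫ ∂μ| ≤ M * ‖p‖ * ‖q‖ := by
  have hle : ∀ᵐ x ∂μ, ‖a x • p x‖ ≤ M * ‖p x‖ := by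
    filter_upwards [hM] with x hx
    rw [norm_smul]
    gcongr
  have hmem : MemLp (fun x => a x • p x) 2 μ :=
    (Lp.memLp p).of_le_mul (ha.smul (Lp.aestronglyMeasurable p)) hle
  have hnorm : ‖hmem.toLp‖ ≤ M * ‖p‖ := by
    refine Lp.norm_le_mul_norm_of_ae_le_mul ?_
    filter_upwards [hmem.coeFn_toLp, hle] with x hx hx'
    rwa [hx]
  have heq : ∫ x, a x * ⟪p x, q x⟫ ∂μ = ⟪hmem.toLp, q⟫ := by
    rw [L2.inner_def]
    refine integral_congr_ae ?_
    filter_upwards [hmem.coeFn_toLp] with x hx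
    rw [hx, real_inner_smul_left]
  rw [heq]
  exact (abs_real_inner_le_norm _ _).trans (by gcongr)

lemma le_integral_mul_inner_self (ha : AEStronglyMeasurable a μ) (hM : ∀ᵐ x ∂μ, ‖a x‖ ≤ M)
    (hm : ∀ᵐ x ∂μ, m ≤ a x) (p : Lp F 2 μ) :
    m * ‖p‖ ^ 2 ≤ ∫ x, a x * ⟪p x, p x⟫ ∂μ := by
  rw [← real_inner_self_eq_norm_sq, L2.inner_def, ← integral_const_mul]
  refine integral_mono_ae ((L2.integrable_inner (𝕜 := ℝ) p p).const_mul m)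
    (integrable_mul_inner ha hM p p) ?_
  filter_upwards [hm] with x hx
  exact mul_le_mul_of_nonneg_right hx real_inner_self_nonneg

/-- The bounded bilinear form `(p, q) ↦ ∫ a p·q dμ` on `L²`. -/
noncomputable def weightedInner (ha : AEStronglyMeasurable a μ)
    (hM : ∀ᵐ x ∂μ, ‖a x‖ ≤ M) : Lp F 2 μ →L[ℝ] Lp F 2 μ →L[ℝ] ℝ :=
  LinearMap.mkContinuous₂
    (LinearMap.mk₂ ℝ (fun p q : Lp F 2 μ => ∫ x, a x * ⟪p x, q x⟫ ∂μ)
      (fun p p' q => by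
        rw [← integral_add (integrable_mul_inner ha hM p q) (integrable_mul_inner ha hM p' q)]
        refine integral_congr_ae ?_
        filter_upwards [Lp.coeFn_add p p'] with x hx
        rw [hx, Pi.add_apply, inner_add_left, mul_add])
      (fun c p q => by
        rw [smul_eq_mul, ← integral_const_mul]
        refine integral_congr_ae ?_
        filter_upwards [Lp.coeFn_smul c p] with x hx
        rw [hx, Pi.smul_apply, real_inner_smul_left]
        ring)
      (fun p q q' => by
        rw [← integral_add (integrable_mul_inner ha hM p q) (integrable_mul_inner ha hM p q')]
        refine integral_congr_ae ?_
        filter_upwards [Lp.coeFn_add q q'] with x hx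
        rw [hx, Pi.add_apply, inner_add_right, mul_add])
      (fun c p q => by
        rw [smul_eq_mul, ← integral_const_mul]
        refine integral_congr_ae ?_
        filter_upwards [Lp.coeFn_smul c q] with x hx
        rw [hx, Pi.smul_apply, real_inner_smul_right]
        ring))
    M (abs_integral_mul_inner_le ha hM)

end WeightedInner

/-! ### Lax–Milgram and energy estimates -/

section LaxMilgram

lemma existsUnique_of_isCoercive {V : Type*} [NormedAddCommGroup V] [InnerProductSpace ℝ V]
    [CompleteSpace V] {B : V →L[ℝ] V →L[ℝ] ℝ} (hB : IsCoercive B) (f : V →L[ℝ] ℝ) :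
    ∃! u : V, ∀ φ, B u φ = f φ := by
  have hiff : ∀ u, (∀ φ, B u φ = f φ) ↔
      hB.continuousLinearEquivOfBilin u = (InnerProductSpace.toDual ℝ V).symm f := by
    intro u
    constructor
    · intro h
      refine ext_inner_right ℝ fun φ => ?_
      rw [hB.continuousLinearEquivOfBilin_apply, h, InnerProductSpace.toDual_symm_apply]
    · intro h φ
      rw [← hB.continuousLinearEquivOfBilin_apply, h, InnerProductSpace.toDual_symm_apply]
  refine ⟨hB.continuousLinearEquivOfBilin.symm ((InnerProductSpace.toDual ℝ V).symm f),
    (hiff _).2 (ContinuousLinearEquiv.apply_symm_apply _ _), fun u hu => ?_⟩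
  rw [← (hiff u).1 hu, ContinuousLinearEquiv.symm_apply_apply]

variable {d : ℕ} {D : Set (Euc d)}

instance : CompleteSpace (H10 D) :=
  (Submodule.isClosed_topologicalClosure (testPairs D)).completeSpace_coe

/-- The gradient as a bounded operator from `H¹₀(D)` to `L²(D)`. -/
noncomputable def gradL (D : Set (Euc d)) : H10 D →L[ℝ] Lp (Euc d) 2 (volume.restrict D) :=
  (WithLp.sndL 2 ℝ _ _).comp (H10 D).subtypeL

variable {A : Euc d → Euc d → ℝ} {ε M m : ℝ}

lemma existsUnique_isWeakSolution (hd : 0 < d) (hD : Bornology.IsBounded D)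
    (ha : AEStronglyMeasurable (fun x => A x (ε⁻¹ • x)) (volume.restrict D))
    (hM : ∀ᵐ x ∂(volume.restrict D), ‖A x (ε⁻¹ • x)‖ ≤ M) (hm0 : 0 < m)
    (hm : ∀ᵐ x ∂(volume.restrict D), m ≤ A x (ε⁻¹ • x)) (f : H10 D →L[ℝ] ℝ) :
    ∃! u : H10 D, IsWeakSolution D A ε f u := by
  obtain ⟨C, hC0, hC⟩ := exists_norm_le_norm_grad hd hD
  let B : H10 D →L[ℝ] H10 D →L[ℝ] ℝ :=
    (weightedInner (F := Euc d) ha hM).bilinearComp (gradL D) (gradL D)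
  have hco : IsCoercive B := by
    refine ⟨m / C ^ 2, by positivity, fun u => ?_⟩
    have h1 : m * ‖gradL D u‖ ^ 2 ≤ B u u := le_integral_mul_inner_self ha hM hm (gradL D u)
    have h2 : ‖u‖ ≤ C * ‖gradL D u‖ := hC u
    calc m / C ^ 2 * ‖u‖ * ‖u‖ = m / C ^ 2 * ‖u‖ ^ 2 := by ring
      _ ≤ m / C ^ 2 * (C * ‖gradL D u‖) ^ 2 := by gcongr
      _ = m * ‖gradL D u‖ ^ 2 := by field_simp
      _ ≤ _ := h1
  exact existsUnique_of_isCoercive hco f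

/-- Testing the equation with `u` itself gives `m‖∇u‖² ≤ f u ≤ ‖f‖ C ‖∇u‖`; one factor `‖∇u‖` is
then divided out. -/
lemma norm_gradL_le {C : ℝ} (hC0 : 0 < C) (hC : ∀ u : H10 D, ‖u‖ ≤ C * ‖gradL D u‖)
    (ha : AEStronglyMeasurable (fun x => A x (ε⁻¹ • x)) (volume.restrict D))
    (hM : ∀ᵐ x ∂(volume.restrict D), ‖A x (ε⁻¹ • x)‖ ≤ M) (hm0 : 0 < m)
    (hm : ∀ᵐ x ∂(volume.restrict D), m ≤ A x (ε⁻¹ • x)) {f : H10 D →L[ℝ] ℝ} {u : H10 D}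
    (hu : IsWeakSolution D A ε f u) : ‖gradL D u‖ ≤ ‖f‖ * C / m := by
  have h1 : m * ‖gradL D u‖ ^ 2 ≤ f u := by
    rw [← hu u]
    exact le_integral_mul_inner_self ha hM hm (gradL D u)
  have h2 : f u ≤ ‖f‖ * (C * ‖gradL D u‖) :=
    (Real.le_norm_self _).trans ((f.le_opNorm u).trans (by gcongr; exact hC u))
  rw [le_div_iff₀ hm0]
  by_contra! hlt
  have hpos : 0 < ‖gradL D u‖ := by
    by_contra! h
    have h0 : ‖gradL D u‖ = 0 := le_antisymm h (norm_nonneg _)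
    rw [h0, zero_mul] at hlt
    exact absurd hlt (not_lt.2 (by positivity))
  nlinarith

/-- The gradient of the weak solution depends Lipschitz continuously on the coefficient. -/
lemma norm_gradL_sub_le {A' : Euc d → Euc d → ℝ}
    (ha : AEStronglyMeasurable (fun x => A x (ε⁻¹ • x)) (volume.restrict D))
    (ha' : AEStronglyMeasurable (fun x => A' x (ε⁻¹ • x)) (volume.restrict D))
    (hM : ∀ᵐ x ∂(volume.restrict D), ‖A x (ε⁻¹ • x)‖ ≤ M)
    (hM' : ∀ᵐ x ∂(volume.restrict D), ‖A' x (ε⁻¹ • x)‖ ≤ M) (hm0 : 0 < m)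
    (hm : ∀ᵐ x ∂(volume.restrict D), m ≤ A x (ε⁻¹ • x)) {η : ℝ} (hη0 : 0 ≤ η)
    (hη : ∀ᵐ x ∂(volume.restrict D), ‖A' x (ε⁻¹ • x) - A x (ε⁻¹ • x)‖ ≤ η)
    {f : H10 D →L[ℝ] ℝ} {u u' : H10 D}
    (hu : IsWeakSolution D A ε f u) (hu' : IsWeakSolution D A' ε f u') :
    ‖gradL D u - gradL D u'‖ ≤ η * ‖gradL D u'‖ / m := by
  set p := gradL D u
  set p' := gradL D u'
  have hpp : gradL D (u - u') = p - p' := map_sub _ _ _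
  have h1 := le_integral_mul_inner_self ha hM hm (p - p')
  have hsub : (p - p' : Lp (Euc d) 2 (volume.restrict D)) =ᵐ[volume.restrict D] p - p' :=
    Lp.coeFn_sub p p'
  have e1 : ∫ x in D, A x (ε⁻¹ • x) * ⟪p x, (p - p') x⟫ = f (u - u') := by
    rw [← hu (u - u'), ← hpp]; rfl
  have e2 : ∫ x in D, A' x (ε⁻¹ • x) * ⟪p' x, (p - p') x⟫ = f (u - u') := by
    rw [← hu' (u - u'), ← hpp]; rfl
  -- Both weak formulations, tested with `u - u'`, have the same right-hand side, so the energy of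
  -- the difference is carried by `A' - A` alone.
  have e3 : ∫ x in D, A x (ε⁻¹ • x) * ⟪(p - p') x, (p - p') x⟫ =
      ∫ x in D, (A' x (ε⁻¹ • x) - A x (ε⁻¹ • x)) * ⟪p' x, (p - p') x⟫ := by
    have i1 := integrable_mul_inner ha hM p (p - p')
    have i2 := integrable_mul_inner ha hM p' (p - p')
    have i3 := integrable_mul_inner ha' hM' p' (p - p')
    simp_rw [sub_mul]
    rw [integral_sub i3 i2, e2, ← e1, ← integral_sub i1 i2]
    refine integral_congr_ae ?_
    filter_upwards [hsub] with x hx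
    rw [← mul_sub, ← inner_sub_left]
    nth_rewrite 1 [hx]
    rfl
  have h2 := abs_integral_mul_inner_le (ha'.sub ha) hη p' (p - p')
  rw [e3] at h1
  have h3 := h1.trans ((le_abs_self _).trans h2)
  rw [le_div_iff₀ hm0]
  by_contra! hlt
  have hpos : 0 < ‖p - p'‖ := by
    by_contra! h
    have h0 : ‖p - p'‖ = 0 := le_antisymm h (norm_nonneg _)
    rw [h0, zero_mul] at hlt
    exact absurd hlt (not_lt.2 (by positivity))
  nlinarith

end LaxMilgram

end TwoScale

namespace TwoScale
open scoped ENNReal RealInnerProductSpace Topology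

/-! ### Uniform boundedness and continuity of the forward map -/

section ForwardMap

variable {d N : ℕ} {D : Set (Euc d)}

/-- The order of quantifiers matters: `K` is a sup bound times `|D|^{1/2}` and precedes the scale
`t`, which makes the later bounds independent of `ε`. -/
lemma exists_oscillating_Lp {F : Type*} [NormedAddCommGroup F] {g : Euc d → Euc d → F}
    (hg : IsContPeriodic D g) (hDo : IsOpen D) (hD : Bornology.IsBounded D) :
    ∃ K, 0 ≤ K ∧ ∀ t : ℝ, ∃ L : Lp F 2 (volume.restrict D), ‖L‖ ≤ K ∧
      L =ᵐ[volume.restrict D] fun x => g x (t • x) := by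
  have : IsFiniteMeasure ((volume : Measure (Euc d)).restrict D) :=
    ⟨by simpa using hD.measure_lt_top⟩
  obtain ⟨M, hM⟩ := hg.exists_bound hD
  have hM' : ∀ t : ℝ, ∀ᵐ x ∂(volume.restrict D), ‖g x (t • x)‖ ≤ max M 0 := fun t =>
    (ae_restrict_iff' hDo.measurableSet).2 <| ae_of_all _ fun x hx =>
      (hM x (subset_closure hx) _).trans (le_max_left _ _)
  refine ⟨measureUnivNNReal (volume.restrict D) ^ (2 : ℝ≥0∞).toReal⁻¹ * max M 0, by positivity,
    fun t => ?_⟩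
  have hmem : MemLp (fun x => g x (t • x)) 2 (volume.restrict D) :=
    MemLp.of_bound (((hg.continuousOn_oscillating t).mono subset_closure).aestronglyMeasurable
      hDo.measurableSet) _ (hM' t)
  refine ⟨hmem.toLp, Lp.norm_le_of_ae_bound (le_max_right M 0) ?_, hmem.coeFn_toLp⟩
  filter_upwards [hmem.coeFn_toLp, hM' t] with x hx hx'
  rwa [hx]

variable {Abar : Euc d → Euc d → ℝ} {ψ : ℕ → Euc d → Euc d → ℝ} {κ : ℝ}

/-- The coefficients `A(z; ·, ·/ε)` are uniformly elliptic and bounded. -/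
lemma exists_coeff_bounds (hDo : IsOpen D) (hD : Bornology.IsBounded D)
    (hAbar : IsContPeriodic D Abar) (hApos : 0 < cellInf D Abar)
    (hψ : ∀ j, IsContPeriodic D (ψ j)) (hsum : Summable fun j => cellSupAbs D (ψ j))
    (hκ : 0 < κ) (hassum : ∑' j, cellSupAbs D (ψ j) ≤ κ / (1 + κ) * cellInf D Abar) :
    ∃ m M, 0 < m ∧ 0 ≤ M ∧ ∀ (z : Param) (t : ℝ),
      AEStronglyMeasurable (fun x => coeff Abar ψ z x (t • x)) (volume.restrict D) ∧
      (∀ᵐ x ∂(volume.restrict D), ‖coeff Abar ψ z x (t • x)‖ ≤ M) ∧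
      ∀ᵐ x ∂(volume.restrict D), m ≤ coeff Abar ψ z x (t • x) := by
  obtain ⟨M, hM⟩ := hAbar.exists_bound hD
  have hae : ∀ {p : Euc d → Prop}, (∀ x ∈ closure D, p x) → ∀ᵐ x ∂(volume.restrict D), p x :=
    fun h => (ae_restrict_iff' hDo.measurableSet).2 <|
      ae_of_all _ fun x hx => h x (subset_closure hx)
  refine ⟨cellInf D Abar / (1 + κ), max (M + ∑' j, cellSupAbs D (ψ j)) 0, by positivity,
    le_max_right _ _, fun z t => ⟨?_, hae fun x hx => ?_, hae fun x hx => ?_⟩⟩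
  · exact ((continuousOn_coeff hD hAbar hψ hsum z t).mono
      subset_closure).aestronglyMeasurable hDo.measurableSet
  · have h1 := abs_coeff_sub_le (Abar := Abar) hD hψ hsum z hx (t • x)
    have h2 := hM x hx (t • x)
    have h3 := abs_add_le (coeff Abar ψ z x (t • x) - Abar x (t • x)) (Abar x (t • x))
    rw [sub_add_cancel] at h3
    rw [Real.norm_eq_abs] at h2 ⊢
    exact le_max_of_le_left (by linarith)
  · exact le_coeff hD hAbar hψ hsum hκ hassum z hx _

lemma weakSolution_spec {A : Euc d → Euc d → ℝ} {ε : ℝ} {f : H10 D →L[ℝ] ℝ}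
    (h : ∃! u : H10 D, IsWeakSolution D A ε f u) :
    IsWeakSolution D A ε f (weakSolution D A ε f) :=
  Classical.epsilon_spec h.exists

lemma norm_le_of_forall_abs_le {x : Euc N} {R : ℝ} (h : ∀ i, |x i| ≤ R) :
    ‖x‖ ≤ ∑ _i : Fin N, R := by
  calc ‖x‖ = ‖∑ i, x i • EuclideanSpace.basisFun (Fin N) ℝ i‖ := by
        congr 1
        exact ((EuclideanSpace.basisFun (Fin N) ℝ).sum_repr x).symm
    _ ≤ ∑ i, ‖x i • EuclideanSpace.basisFun (Fin N) ℝ i‖ := norm_sum_le _ _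
    _ ≤ _ := Finset.sum_le_sum fun i _ => by simpa [norm_smul] using h i

/-- The forward map is bounded uniformly in the microscale, and continuous. -/
lemma forwardMap_bound_and_continuous (hd : 0 < d) (hDo : IsOpen D)
    (hD : Bornology.IsBounded D) (f : H10 D →L[ℝ] ℝ)
    (hAbar : IsContPeriodic D Abar) (hApos : 0 < cellInf D Abar)
    (hψ : ∀ j, IsContPeriodic D (ψ j)) (hsum : Summable fun j => cellSupAbs D (ψ j))
    (hκ : 0 < κ) (hassum : ∑' j, cellSupAbs D (ψ j) ≤ κ / (1 + κ) * cellInf D Abar)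
    {l : Fin N → Euc d → Euc d → Euc d} (hl : ∀ i, IsContPeriodic D (l i)) :
    (∀ ε z, ∃! u : H10 D, IsWeakSolution D (coeff Abar ψ z) ε f u) ∧
    (∃ R, ∀ ε z, ‖forwardMap D f Abar ψ l ε z‖ ≤ R) ∧
    ∀ ε, Continuous (forwardMap D f Abar ψ l ε) := by
  obtain ⟨m, M, hm0, hM0, hA⟩ :=
    exists_coeff_bounds hDo hD hAbar hApos hψ hsum hκ hassum
  obtain ⟨C, hC0, hC⟩ := exists_norm_le_norm_grad hd hD
  have hex : ∀ ε z, ∃! u : H10 D, IsWeakSolution D (coeff Abar ψ z) ε f u := fun ε z =>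
    existsUnique_isWeakSolution hd hD (hA z ε⁻¹).1 (hA z ε⁻¹).2.1 hm0 (hA z ε⁻¹).2.2 f
  have hsol := fun ε z => weakSolution_spec (hex ε z)
  choose K hK0 L hLK hL using fun i => exists_oscillating_Lp (hl i) hDo hD
  -- Each observation is a bounded linear functional of the gradient in L², so bounds and continuity
  -- need only be shown for the gradient.
  have hG : ∀ ε z i, forwardMap D f Abar ψ l ε z i =
      ⟪L i ε⁻¹, gradL D (weakSolution D (coeff Abar ψ z) ε f)⟫ := by
    intro ε z i
    rw [L2.inner_def]
    refine integral_congr_ae ?_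
    filter_upwards [hL i ε⁻¹] with x hx
    rw [hx]
    rfl
  have hgrad : ∀ ε z, ‖gradL D (weakSolution D (coeff Abar ψ z) ε f)‖ ≤ ‖f‖ * C / m :=
    fun ε z => norm_gradL_le hC0 hC (hA z ε⁻¹).1 (hA z ε⁻¹).2.1 hm0 (hA z ε⁻¹).2.2 (hsol ε z)
  refine ⟨hex, ⟨∑ _i : Fin N, (∑ j, K j) * (‖f‖ * C / m), fun ε z => ?_⟩, fun ε => ?_⟩
  · refine norm_le_of_forall_abs_le fun i => ?_
    rw [hG]
    refine (abs_real_inner_le_norm _ _).trans ?_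
    have h1 : ‖L i ε⁻¹‖ ≤ ∑ j, K j :=
      (hLK i _).trans (Finset.single_le_sum (fun j _ => hK0 j) (Finset.mem_univ i))
    exact mul_le_mul h1 (hgrad ε z) (norm_nonneg _) (Finset.sum_nonneg fun j _ => hK0 j)
  · set s : ℕ → ℝ := fun j => cellSupAbs D (ψ j)
    have hs0 : ∀ j, 0 ≤ s j := fun j => cellSupAbs_nonneg D (ψ j)
    have hcont : Continuous fun z => gradL D (weakSolution D (coeff Abar ψ z) ε f) := by
      refine continuous_iff_continuousAt.2 fun z => ?_
      rw [ContinuousAt, tendsto_iff_norm_sub_tendsto_zero]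
      refine squeeze_zero (g := fun z' => paramDist s z' z * (‖f‖ * C / m) / m)
        (fun _ => norm_nonneg _) (fun z' => ?_) ?_
      · have hη : ∀ᵐ x ∂(volume.restrict D),
            ‖coeff Abar ψ z x (ε⁻¹ • x) - coeff Abar ψ z' x (ε⁻¹ • x)‖ ≤ paramDist s z' z :=
          (ae_restrict_iff' hDo.measurableSet).2 <| ae_of_all _ fun x hx => by
            rw [norm_sub_rev]
            exact abs_coeff_sub_coeff_le hD hψ hsum z' z (subset_closure hx) _
        have := paramDist_nonneg hs0 z' z
        refine (norm_gradL_sub_le (hA z' ε⁻¹).1 (hA z ε⁻¹).1 (hA z' ε⁻¹).2.1 (hA z ε⁻¹).2.1 hm0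
          (hA z' ε⁻¹).2.2 this hη (hsol ε z') (hsol ε z)).trans ?_
        have := hgrad ε z
        gcongr
      · have := ((tendsto_paramDist hs0 hsum z).mul_const (‖f‖ * C / m)).div_const m
        simpa using this
    have : forwardMap D f Abar ψ l ε = fun z => WithLp.toLp 2 fun i =>
        ⟪L i ε⁻¹, gradL D (weakSolution D (coeff Abar ψ z) ε f)⟫ := by
      ext z i
      exact hG ε z i
    rw [this]
    refine (PiLp.continuous_toLp 2 _).comp (continuous_pi fun i => ?_)
    exact continuous_const.inner hcont

end ForwardMap

/-! ### The misfit -/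

section Misfit

variable {N : ℕ}

/-- The quadratic form `½ xᵀ S⁻¹ x`. -/
noncomputable def noisePotential (S : Matrix (Fin N) (Fin N) ℝ) (x : Euc N) : ℝ :=
  2⁻¹ * (x.ofLp ⬝ᵥ S⁻¹.mulVec x.ofLp)

lemma noisePotential_eq_inner (S : Matrix (Fin N) (Fin N) ℝ) (x : Euc N) :
    noisePotential S x = 2⁻¹ * ⟪x, Matrix.toEuclideanCLM (𝕜 := ℝ) S⁻¹ x⟫ := by
  rw [noisePotential, Matrix.inner_toEuclideanCLM]

lemma measurable_noisePotential (S : Matrix (Fin N) (Fin N) ℝ) :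
    Measurable (noisePotential S) := by
  have : noisePotential S = fun x => 2⁻¹ * ⟪x, Matrix.toEuclideanCLM (𝕜 := ℝ) S⁻¹ x⟫ :=
    funext (noisePotential_eq_inner S)
  rw [this]
  fun_prop

lemma noisePotential_nonneg {S : Matrix (Fin N) (Fin N) ℝ} (hS : S.PosDef) (x : Euc N) :
    0 ≤ noisePotential S x := by
  have := hS.inv.posSemidef.dotProduct_mulVec_nonneg x.ofLp
  rw [star_trivial] at this
  rw [noisePotential]
  positivity

lemma noisePotential_le (S : Matrix (Fin N) (Fin N) ℝ) {x : Euc N} {R : ℝ} (hx : ‖x‖ ≤ R) :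
    noisePotential S x ≤ R ^ 2 * ‖Matrix.toEuclideanCLM (𝕜 := ℝ) S⁻¹‖ := by
  set T := Matrix.toEuclideanCLM (𝕜 := ℝ) S⁻¹
  have h1 : ⟪x, T x⟫ ≤ R * (‖T‖ * R) :=
    (real_inner_le_norm _ _).trans <| mul_le_mul hx ((T.le_opNorm x).trans (by gcongr))
      (norm_nonneg _) ((norm_nonneg _).trans hx)
  rw [noisePotential_eq_inner]
  nlinarith [norm_nonneg T, sq_nonneg R, mul_nonneg (norm_nonneg T) (sq_nonneg R)]

lemma abs_noisePotential_sub_le (S : Matrix (Fin N) (Fin N) ℝ) {x y : Euc N} {R : ℝ}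
    (hx : ‖x‖ ≤ R) (hy : ‖y‖ ≤ R) :
    |noisePotential S x - noisePotential S y| ≤
      R * ‖Matrix.toEuclideanCLM (𝕜 := ℝ) S⁻¹‖ * ‖x - y‖ := by
  rw [noisePotential_eq_inner, noisePotential_eq_inner]
  set T := Matrix.toEuclideanCLM (𝕜 := ℝ) S⁻¹
  -- This splitting uses linearity only, not the symmetry of `T`.
  have e : 2⁻¹ * ⟪x, T x⟫ - 2⁻¹ * ⟪y, T y⟫ = 2⁻¹ * (⟪x - y, T x⟫ + ⟪y, T (x - y)⟫) := by
    rw [map_sub, inner_sub_left, inner_sub_right]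
    ring
  have hR : 0 ≤ R := (norm_nonneg _).trans hx
  have h1 : |⟪x - y, T x⟫| ≤ ‖x - y‖ * (‖T‖ * R) :=
    (abs_real_inner_le_norm _ _).trans <| by
      gcongr
      exact (T.le_opNorm x).trans (by gcongr)
  have h2 : |⟪y, T (x - y)⟫| ≤ R * (‖T‖ * ‖x - y‖) :=
    (abs_real_inner_le_norm _ _).trans <| mul_le_mul hy (T.le_opNorm _) (norm_nonneg _) hR
  rw [e, abs_mul, abs_of_pos (by norm_num : (0 : ℝ) < 2⁻¹)]
  have h3 := abs_add_le ⟪x - y, T x⟫ ⟪y, T (x - y)⟫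
  nlinarith

end Misfit

/-! ### Well-posedness for a bounded measurable forward map -/

section WellPosed

variable {N : ℕ} {S : Matrix (Fin N) (Fin N) ℝ} {G : Param → Euc N}

lemma measurable_uncurry_noisePotential_sub (S : Matrix (Fin N) (Fin N) ℝ) (hG : Measurable G) :
    Measurable (Function.uncurry fun (δ : Euc N) (z : Param) => noisePotential S (δ - G z)) := by
  have h : Measurable fun p : Euc N × Param => p.1 - G p.2 := by fun_prop
  exact (measurable_noisePotential S).comp h

lemma measurable_noisePotential_sub (S : Matrix (Fin N) (Fin N) ℝ) (hG : Measurable G)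
    (δ : Euc N) : Measurable fun z : Param => noisePotential S (δ - G z) := by
  have h : Measurable fun z : Param => δ - G z := by fun_prop
  exact (measurable_noisePotential S).comp h

/-- All residuals lie in the ball of radius `r + R`, where the potential is bounded and Lipschitz.
The constant sees `G` only through `R`, so a bound `R` uniform in `ε` makes it uniform in `ε`. -/
lemma hellingerDist_noisePotential_le (hS : S.PosDef) (hG : Measurable G) {r R : ℝ}
    (hR : ∀ z, ‖G z‖ ≤ R) {δ δ' : Euc N} (hδ : ‖δ‖ ≤ r) (hδ' : ‖δ'‖ ≤ r) :
    hellingerDist (bayesMeasure fun z => noisePotential S (δ - G z))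
        (bayesMeasure fun z => noisePotential S (δ' - G z)) ≤
      Real.exp ((r + R) ^ 2 * ‖Matrix.toEuclideanCLM (𝕜 := ℝ) S⁻¹‖ / 2) *
        ((r + R) * ‖Matrix.toEuclideanCLM (𝕜 := ℝ) S⁻¹‖) * ‖δ - δ'‖ := by
  have hdiff : ∀ δ : Euc N, ‖δ‖ ≤ r → ∀ z, ‖δ - G z‖ ≤ r + R :=
    fun δ hδ z => (norm_sub_le _ _).trans (add_le_add hδ (hR z))
  rw [mul_assoc]
  refine hellingerDist_bayesMeasure_le (measurable_noisePotential_sub S hG δ)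
    (measurable_noisePotential_sub S hG δ') (fun z => noisePotential_nonneg hS _)
    (fun z => noisePotential_nonneg hS _) (fun z => noisePotential_le S (hdiff δ hδ z))
    (fun z => noisePotential_le S (hdiff δ' hδ' z)) fun z => ?_
  have := abs_noisePotential_sub_le S (hdiff δ hδ z) (hdiff δ' hδ' z)
  rwa [sub_sub_sub_cancel_right] at this

/-- The Bayes formula defines the posterior. -/
lemma exists_posterior (hS : S.PosDef) (hG : Measurable G) {Φ : Euc N → Param → ℝ}
    (hΦ : ∀ δ z, Φ δ z = noisePotential S (δ - G z)) :
    (∀ δ : Euc N,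
      0 < normConst (Φ δ) ∧ IsProbabilityMeasure (bayesMeasure (Φ δ)) ∧
      (bayesMeasure (Φ δ)).rnDeriv prior
        =ᵐ[prior] fun z => ENNReal.ofReal (Real.exp (-Φ δ z) / normConst (Φ δ))) ∧
    ∃ post : Kernel (Euc N) Param,
      IsMarkovKernel post ∧ (∀ δ, post δ = bayesMeasure (Φ δ)) ∧
      ∀ {Ω : Type*} [MeasurableSpace Ω] (P : Measure Ω) [IsProbabilityMeasure P]
        (Z : Ω → Param) (ν : Ω → Euc N),
        HasLaw Z prior P → HasLaw ν (multivariateGaussian 0 S) P → IndepFun Z ν P →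
        HasCondDistrib Z (fun ω => G (Z ω) + ν ω) post P ∧
        ∀ η : Kernel (Euc N) Param, IsMarkovKernel η →
          HasCondDistrib Z (fun ω => G (Z ω) + ν ω) η P → ∀ᵐ δ : Euc N, η δ = post δ := by
  obtain rfl : Φ = fun δ z => noisePotential S (δ - G z) := funext₂ hΦ
  have hw0 := noisePotential_nonneg hS
  have hΦu := measurable_uncurry_noisePotential_sub S hG
  have hΦm := measurable_noisePotential_sub S hG
  refine ⟨fun δ => ⟨normConst_pos (hΦm δ) fun z => hw0 _,
    isProbabilityMeasure_bayesMeasure (hΦm δ) fun z => hw0 _, rnDeriv_bayesMeasure (hΦm δ)⟩,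
    bayesKernel fun δ z => noisePotential S (δ - G z),
    isMarkovKernel_bayesKernel hΦu fun δ z => hw0 _, bayesKernel_apply hΦu, ?_⟩
  intro Ω _ P _ Z ν hZ hν hind
  obtain ⟨c, hc, hγ⟩ := multivariateGaussian_eq_withDensity hS
  exact hasCondDistrib_bayesKernel hG (measurable_noisePotential S) hw0 hc hγ P hZ hν hind

end WellPosed

end TwoScale

open TwoScale in
theorem proposition4p1 {d N : ℕ} (hd : 0 < d)
    (D : Set (Euc d)) (hDo : IsOpen D) (hDc : IsConnected D) (hDb : Bornology.IsBounded D)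
    (f : H10 D →L[ℝ] ℝ)
    (Abar : Euc d → Euc d → ℝ) (hAbar : IsContPeriodic D Abar) (hApos : 0 < cellInf D Abar)
    (ψ : ℕ → Euc d → Euc d → ℝ) (hψ : ∀ j, IsContPeriodic D (ψ j))
    (κ : ℝ) (hκ : 0 < κ) (hsum : Summable fun j => cellSupAbs D (ψ j))
    (hassum : ∑' j, cellSupAbs D (ψ j) ≤ κ / (1 + κ) * cellInf D Abar)
    (l : Fin N → Euc d → Euc d → Euc d) (hl : ∀ i, IsContPeriodic D (l i))
    (S : Matrix (Fin N) (Fin N) ℝ) (hS : S.PosDef) :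
    -- for every microscale the posterior exists and is given by the Bayes formula
    (∀ ε : ℝ, 0 < ε →
      -- the forward problem is uniquely solvable and the forward map is measurable
      (∀ z, ∃! u : H10 D, IsWeakSolution D (coeff Abar ψ z) ε f u) ∧
      Measurable (forwardMap D f Abar ψ l ε) ∧
      -- for each datum the Bayes formula defines a probability measure
      (∀ δ : Euc N,
        0 < normConst (misfit D f Abar ψ l S ε δ) ∧
        IsProbabilityMeasure (bayesMeasure (misfit D f Abar ψ l S ε δ)) ∧
        (bayesMeasure (misfit D f Abar ψ l S ε δ)).rnDeriv prior
          =ᵐ[prior] fun z => ENNReal.ofReal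
            (Real.exp (-misfit D f Abar ψ l S ε δ z) / normConst (misfit D f Abar ψ l S ε δ))) ∧
      -- these measures are the conditional law of `z` given the datum `G^ε(z) + ν`, where `z` has
      -- the prior law and `ν` is an independent centred Gaussian with covariance `S`; any other
      -- version of this conditional law agrees with them for almost every datum
      ∃ post : Kernel (Euc N) Param,
        IsMarkovKernel post ∧
        (∀ δ, post δ = bayesMeasure (misfit D f Abar ψ l S ε δ)) ∧
        ∀ {Ω : Type*} [MeasurableSpace Ω] (P : Measure Ω) [IsProbabilityMeasure P]
          (Z : Ω → Param) (ν : Ω → Euc N),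
          HasLaw Z prior P → HasLaw ν (multivariateGaussian 0 S) P → IndepFun Z ν P →
          HasCondDistrib Z (fun ω => forwardMap D f Abar ψ l ε (Z ω) + ν ω) post P ∧
          ∀ η : Kernel (Euc N) Param, IsMarkovKernel η →
            HasCondDistrib Z (fun ω => forwardMap D f Abar ψ l ε (Z ω) + ν ω) η P →
            ∀ᵐ δ : Euc N, η δ = post δ) ∧
    -- local Lipschitz dependence on the data, with a constant that depends on `r` but not on `ε`
    ∀ r : ℝ, ∃ c : ℝ, ∀ ε : ℝ, 0 < ε → ∀ δ δ' : Euc N, ‖δ‖ ≤ r → ‖δ'‖ ≤ r →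
      hellingerDist (bayesMeasure (misfit D f Abar ψ l S ε δ))
        (bayesMeasure (misfit D f Abar ψ l S ε δ')) ≤ c * ‖δ - δ'‖ := by
  obtain ⟨hex, ⟨R, hR⟩, hcont⟩ := forwardMap_bound_and_continuous hd hDo hDb f hAbar hApos hψ hsum
    hκ hassum hl
  have hmisfit : ∀ ε, misfit D f Abar ψ l S ε =
      fun δ z => noisePotential S (δ - forwardMap D f Abar ψ l ε z) := fun ε => rfl
  refine ⟨fun ε _ => ⟨hex ε, (hcont ε).measurable, ?_⟩, fun r =>
    ⟨Real.exp ((r + R) ^ 2 * ‖Matrix.toEuclideanCLM (𝕜 := ℝ) S⁻¹‖ / 2) *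
      ((r + R) * ‖Matrix.toEuclideanCLM (𝕜 := ℝ) S⁻¹‖), fun ε _ δ δ' hδ hδ' => ?_⟩⟩
  · exact exists_posterior hS (hcont ε).measurable fun δ z => by rw [hmisfit]
  · rw [hmisfit]
    exact hellingerDist_noisePotential_le hS (hcont ε).measurable (hR ε) hδ hδ'
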